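/- Let $L$ and $H$ be finite-dimensional Lie algebras over an arbitrary field $\mathbb F$, let $M$ be an ideal of $L$ and $N$ an ideal of $H$, and suppose that $L=M\rtimes\langle x\rangle$ and $H=N\rtimes\langle y\rangle$ with $0\neq x\in L$ and $0\neq y\in H$ (so $M$ and $N$ have codimension one). Let $\alpha\colon U(L)\to U(H)$ be an isomorphism of (unital associative) $\mathbb F$-algebras between the universal enveloping algebras. For an ideal $I$ of a Lie algebra $K$, write $I\,U(K)$ for the right ideal of $U(K)$ generated by $I$. Write $K'=[K,K]$ and $K''=[K',K']$; $K$ is metabelian if $K''=0$. (1) If $\alpha(M\,U(L))=N\,U(H)$ and at least one of $M$, $N$ is abelian, then $L\cong H$. (2) If $M=L'$ and $N=H'$, then $L/L''\cong H/H''$. If, in addition, $L$ or $H$ is metabelian, then $L\cong H$. -/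

import Mathlib

/-- `L = M ⋊ ⟨x⟩`: the Lie algebra `L` is the internal semidirect product of the ideal `M` and the
one-dimensional subalgebra spanned by the nonzero element `x`. -/
def IsSemidirectLine {F L : Type*} [Field F] [LieRing L] [LieAlgebra F L]
    (M : LieIdeal F L) (x : L) : Prop :=
  x ≠ 0 ∧ IsCompl M.toSubmodule (Submodule.span F {x})

/-- The right ideal `M U(L)` of `U(L)` generated by (the image of) an ideal `M` of `L`, as a linear
subspace: all finite sums of products `m * u` with `m ∈ M` and `u ∈ U(L)`. -/
def rightIdealGen {F L : Type*} [Field F] [LieRing L] [LieAlgebra F L] (M : LieIdeal F L) :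
    Submodule F (UniversalEnvelopingAlgebra F L) :=
  Submodule.span F {z | ∃ m ∈ M, ∃ u : UniversalEnvelopingAlgebra F L,
    z = UniversalEnvelopingAlgebra.ι F m * u}

/-- A Lie algebra is metabelian if its second derived subalgebra `L''` vanishes. -/
def IsMetabelian (F L : Type*) [Field F] [LieRing L] [LieAlgebra F L] : Prop :=
  LieAlgebra.derivedSeries F L 2 = ⊥

/-!
The isomorphism is recovered from the first two layers of the filtration of `U(L)` by the powers of
the two-sided ideal `J = M U(L)`, without the Poincaré–Birkhoff–Witt theorem.

*Normalization.* `U(L) / M U(L)` is the polynomial ring in the class of `x`. Hence an isomorphism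
`α` with `α (M U(L)) = N U(H)` sends `x` to `c y + d` modulo `N U(H)` with `c ≠ 0`. Rescaling `y` and
composing with a shift automorphism of `U(H)` gives `α x ≡ y` (`exists_normalized`).

*First layer.* The space `J / (J² + J x)` is `M / [M, M]`, and commutation with `x` induces `ad x` on
it. Both are preserved by `α`, and so `L / [M, M] ≅ H / [N, N]` (`nonempty_quotient_lie_equiv`). That
`M / [M, M]` embeds in the first layer is seen on a representation. The normal ordering
(`exists_normalOrdering`) embeds `U(L)` in the polynomials in `x` over `U(M)`, and its constant
coefficient reduces the question to powers of the augmentation ideal `ω` of `U(M)`. There small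
nilpotent representations suffice (`exists_linearMap_truncated`).

*Second layer.* Suppose that `M` is abelian. Then `J² / (J³ + J² x)` is a quotient of the symmetric
square of `M`, whereas the second layer for `N` maps onto the symmetric square of `N / [N, N] ≅ M`. A
surjective endomorphism of a finite-dimensional space is injective, and so the commutators of `N`
vanish in the second layer (`ι_lie_mem_layerSubspace`). Elements of a Lie algebra `K` that lie in the
cube of the augmentation ideal of `U(K)` lie in `[K, [K, K]]`
(`mem_lowerCentralSeries_two_of_ι_mem_pow_three`). Therefore `[N, N] = [N, [N, N]]`, and `[N, N]` maps
into every power of `N U(H)`. These powers intersect in zero, since those of `M U(L)` do: `U(M)` is a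
polynomial ring. So `[N, N]` vanishes in `U(H)`, and it is central in `H`, because the adjoint
representation factors through `U(H)`. Hence `[N, N] = [N, [N, N]] = 0`, and `N` is abelian
(`lie_eq_zero_of_lie_eq_zero`).

*The derived algebra.* `L' U(L)` is the ideal generated by all commutators of `U(L)`, and every
isomorphism preserves it (`map_rightIdealGen_derivedSeries`). This reduces the second part of the
theorem to the first two steps.
-/

namespace UniversalEnvelopingAlgebra

/-! ### Homomorphisms out of the enveloping algebra -/

section Lift

attribute [local instance] LieRing.ofAssociativeRing

variable {F K A : Type*} [Field F] [LieRing K] [LieAlgebra F K] [Ring A] [Algebra F A]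

variable (F K) in
/-- The canonical map of a Lie algebra to its enveloping algebra, as a linear map. -/
def ιₗ : K →ₗ[F] UniversalEnvelopingAlgebra F K :=
  (ι F : K →ₗ⁅F⁆ UniversalEnvelopingAlgebra F K)

theorem ιₗ_apply (a : K) : ιₗ F K a = ι F a := rfl

theorem ι_lie (a b : K) : ι F ⁅a, b⁆ = ι F a * ι F b - ι F b * ι F a := by
  rw [LieHom.map_lie, LieRing.of_associative_ring_bracket]

/-- The universal property, with the Lie condition spelled out as a commutator identity. -/
theorem exists_algHom (f : K →ₗ[F] A) (hf : ∀ a b, f ⁅a, b⁆ = f a * f b - f b * f a) :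
    ∃ φ : UniversalEnvelopingAlgebra F K →ₐ[F] A, ∀ a, φ (ι F a) = f a := by
  let g : K →ₗ⁅F⁆ A :=
    { f with map_lie' := by intro a b; simpa [LieRing.of_associative_ring_bracket] using hf a b }
  exact ⟨lift F g, fun a => lift_ι_apply F g a⟩

theorem algHom_ext_ι {φ ψ : UniversalEnvelopingAlgebra F K →ₐ[F] A}
    (h : ∀ a, φ (ι F a) = ψ (ι F a)) : φ = ψ := by
  apply hom_ext
  ext a
  exact h a

theorem adjoin_range_ι :
    Algebra.adjoin F (Set.range (ι F : K → UniversalEnvelopingAlgebra F K)) = ⊤ := by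
  set B := Algebra.adjoin F (Set.range (ι F : K → UniversalEnvelopingAlgebra F K)) with hB
  let f : K →ₗ[F] B := LinearMap.codRestrict (Subalgebra.toSubmodule B)
    (ιₗ F K) (fun a => Algebra.subset_adjoin ⟨a, rfl⟩)
  obtain ⟨φ, hφ⟩ := exists_algHom (A := B) f (fun a b => Subtype.ext (ι_lie a b))
  have h : B.val.comp φ = AlgHom.id F _ := algHom_ext_ι fun a => by
    simp only [AlgHom.comp_apply, hφ]; rfl
  refine eq_top_iff.2 fun u _ => ?_
  have := DFunLike.congr_fun h u
  rw [AlgHom.id_apply] at this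
  rw [← this]
  exact (φ u).2

/-- Elements are built from `1` by left multiplications with elements of the Lie algebra. -/
theorem induction_left (S : Submodule F (UniversalEnvelopingAlgebra F K)) (h1 : 1 ∈ S)
    (hS : ∀ a, ∀ u ∈ S, ι F a * u ∈ S) (u : UniversalEnvelopingAlgebra F K) : u ∈ S := by
  have key : ∀ v : UniversalEnvelopingAlgebra F K, ∀ w ∈ S, v * w ∈ S := by
    intro v
    have hv : v ∈ Algebra.adjoin F (Set.range (ι F : K → UniversalEnvelopingAlgebra F K)) := by
      rw [adjoin_range_ι]; trivial
    induction hv using Algebra.adjoin_induction with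
    | mem v hv => obtain ⟨a, rfl⟩ := hv; exact hS a
    | algebraMap r => intro w hw; rw [← Algebra.smul_def]; exact S.smul_mem r hw
    | add v w _ _ hv hw => intro z hz; rw [add_mul]; exact S.add_mem (hv z hz) (hw z hz)
    | mul v w _ _ hv hw => intro z hz; rw [mul_assoc]; exact hv _ (hw z hz)
  simpa using key u 1 h1

/-- A derivation `D` of a Lie algebra extends to a derivation of the enveloping algebra. -/
theorem exists_derivation (D : K →ₗ[F] K) (hD : ∀ a b, D ⁅a, b⁆ = ⁅D a, b⁆ + ⁅a, D b⁆) :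
    ∃ δ : UniversalEnvelopingAlgebra F K →ₗ[F] UniversalEnvelopingAlgebra F K,
      (∀ a, δ (ι F a) = ι F (D a)) ∧ ∀ u v, δ (u * v) = δ u * v + u * δ v := by
  -- `u ↦ u + ε δ(u)` is the algebra homomorphism to the dual numbers with `a ↦ a + ε D(a)`
  let f : K →ₗ[F] TrivSqZeroExt (UniversalEnvelopingAlgebra F K)
      (UniversalEnvelopingAlgebra F K) :=
    (TrivSqZeroExt.inlAlgHom F (UniversalEnvelopingAlgebra F K)
      (UniversalEnvelopingAlgebra F K)).toLinearMap ∘ₗ ιₗ F K +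
    (TrivSqZeroExt.inrHom (UniversalEnvelopingAlgebra F K)
      (UniversalEnvelopingAlgebra F K)).restrictScalars F ∘ₗ ιₗ F K ∘ₗ D
  have f1 : ∀ a, (f a).fst = ι F a := fun a => add_zero _
  have f2 : ∀ a, (f a).snd = ι F (D a) := fun a => zero_add _
  obtain ⟨φ, hφ⟩ := exists_algHom f (fun a b => by
    refine TrivSqZeroExt.ext ?_ ?_
    · rw [TrivSqZeroExt.fst_sub, TrivSqZeroExt.fst_mul, TrivSqZeroExt.fst_mul, f1, f1, f1, ι_lie]
    · rw [TrivSqZeroExt.snd_sub, TrivSqZeroExt.snd_mul, TrivSqZeroExt.snd_mul, f2, f2, f2, f1, f1,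
        hD, map_add, ι_lie, ι_lie]
      simp only [smul_eq_mul, MulOpposite.smul_eq_mul_unop, MulOpposite.unop_op]
      abel)
  have h1 : ∀ u, (φ u).fst = u := by
    intro u
    have : (TrivSqZeroExt.fstHom F _ _).comp φ = AlgHom.id F _ := algHom_ext_ι fun a => by
      rw [AlgHom.comp_apply, hφ, AlgHom.id_apply]
      exact f1 a
    exact DFunLike.congr_fun this u
  refine ⟨(TrivSqZeroExt.sndHom _ _).restrictScalars F ∘ₗ φ.toLinearMap, fun a => ?_,
    fun u v => ?_⟩
  · exact (congrArg TrivSqZeroExt.snd (hφ a)).trans (f2 a)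
  · change (φ (u * v)).snd = (φ u).snd * v + u * (φ v).snd
    rw [map_mul, TrivSqZeroExt.snd_mul, h1, h1, add_comm]
    rfl

end Lift

/-! ### The ideal generated by a Lie ideal -/

section RightIdeal

variable {F L : Type*} [Field F] [LieRing L] [LieAlgebra F L] {M : LieIdeal F L}

theorem mul_mem_rightIdealGen {m : L} (hm : m ∈ M) (u : UniversalEnvelopingAlgebra F L) :
    ι F m * u ∈ rightIdealGen M :=
  Submodule.subset_span ⟨m, hm, u, rfl⟩

theorem ι_mem_rightIdealGen {m : L} (hm : m ∈ M) : ι F m ∈ rightIdealGen M := by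
  simpa using mul_mem_rightIdealGen hm 1

theorem rightIdealGen_induction {S : Submodule F (UniversalEnvelopingAlgebra F L)}
    (h : ∀ m ∈ M, ∀ u, ι F m * u ∈ S) : rightIdealGen M ≤ S :=
  Submodule.span_le.2 (by rintro _ ⟨m, hm, u, rfl⟩; exact h m hm u)

theorem mul_mem_rightIdealGen_right {j : UniversalEnvelopingAlgebra F L}
    (hj : j ∈ rightIdealGen M) (u : UniversalEnvelopingAlgebra F L) :
    j * u ∈ rightIdealGen M := by
  have : rightIdealGen M ≤ (rightIdealGen M).comap (LinearMap.mulRight F u) :=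
    rightIdealGen_induction fun m hm v => by
      simpa [mul_assoc] using mul_mem_rightIdealGen hm (v * u)
  exact this hj

/-- Since `M` is an ideal of `L`, the right ideal `M U(L)` is a left ideal as well. -/
theorem mul_mem_rightIdealGen_left {j : UniversalEnvelopingAlgebra F L}
    (hj : j ∈ rightIdealGen M) (u : UniversalEnvelopingAlgebra F L) :
    u * j ∈ rightIdealGen M := by
  have key : ∀ a : L, ∀ j ∈ rightIdealGen M, ι F a * j ∈ rightIdealGen M := by
    intro a
    have : rightIdealGen M ≤ (rightIdealGen M).comap (LinearMap.mulLeft F (ι F a)) :=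
      rightIdealGen_induction fun m hm v => by
        have h : ι F a * (ι F m * v) = ι F m * (ι F a * v) + ι F ⁅a, m⁆ * v := by
          rw [ι_lie]; noncomm_ring
        simp only [Submodule.mem_comap, LinearMap.mulLeft_apply, h]
        exact add_mem (mul_mem_rightIdealGen hm _)
          (mul_mem_rightIdealGen (lie_mem_right F L M a m hm) _)
    exact this
  have := induction_left ((rightIdealGen M).comap (LinearMap.mulRight F j)) (by simpa using hj)
    (fun a v hv => by
      simp only [Submodule.mem_comap, LinearMap.mulRight_apply, mul_assoc] at hv ⊢
      exact key a _ hv) u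
  exact this

theorem rightIdealGen_mul_top : rightIdealGen M * ⊤ = rightIdealGen M :=
  le_antisymm (Submodule.mul_le.2 fun _ hj u _ => mul_mem_rightIdealGen_right hj u)
    fun j hj => by simpa using Submodule.mul_mem_mul hj (Submodule.mem_top (x := 1))

theorem top_mul_rightIdealGen : ⊤ * rightIdealGen M = rightIdealGen M :=
  le_antisymm (Submodule.mul_le.2 fun u _ _ hj => mul_mem_rightIdealGen_left hj u)
    fun j hj => by simpa using Submodule.mul_mem_mul (Submodule.mem_top (x := 1)) hj

theorem rightIdealGen_eq_mul_top :
    rightIdealGen M = M.toSubmodule.map (ιₗ F L) * ⊤ := by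
  apply le_antisymm
  · exact rightIdealGen_induction fun m hm u =>
      Submodule.mul_mem_mul (Submodule.mem_map_of_mem hm) Submodule.mem_top
  · rw [Submodule.mul_le]
    rintro _ ⟨m, hm, rfl⟩ u -
    exact mul_mem_rightIdealGen hm u

theorem rightIdealGen_pow_succ_mul_top (k : ℕ) :
    rightIdealGen M ^ (k + 1) * ⊤ = rightIdealGen M ^ (k + 1) := by
  rw [pow_succ, mul_assoc, rightIdealGen_mul_top]

theorem top_mul_rightIdealGen_pow_mul_top (k : ℕ) :
    ⊤ * (rightIdealGen M ^ k * ⊤) ≤ rightIdealGen M ^ k * ⊤ := by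
  cases k with
  | zero => simp only [pow_zero, one_mul]; exact le_top
  | succ k => rw [pow_succ', ← mul_assoc, ← mul_assoc, top_mul_rightIdealGen]

theorem apply_mem_of_stable {E : Type*} [AddCommGroup E] [Module F E]
    (R : UniversalEnvelopingAlgebra F L →ₐ[F] Module.End F E) {W : Submodule F E}
    (h : ∀ a, ∀ e ∈ W, R (ι F a) e ∈ W) {e : E} (he : e ∈ W) (u : UniversalEnvelopingAlgebra F L) :
    R u e ∈ W :=
  induction_left (W.comap ((LinearMap.applyₗ e) ∘ₗ R.toLinearMap)) (by simpa using he)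
    (fun a v hv => by
      simp only [Submodule.mem_comap, LinearMap.comp_apply, AlgHom.toLinearMap_apply,
        LinearMap.applyₗ_apply_apply, map_mul, Module.End.mul_apply] at hv ⊢
      exact h a _ hv) u

/-- In a representation with a descending filtration that `L` respects and `M` shifts by one,
the power `(M U(L))ᵏ` shifts the filtration by `k`. -/
theorem apply_mem_of_mem_rightIdealGen_pow {E : Type*} [AddCommGroup E] [Module F E]
    (R : UniversalEnvelopingAlgebra F L →ₐ[F] Module.End F E) (W : ℕ → Submodule F E)
    (h0 : ∀ a i, ∀ e ∈ W i, R (ι F a) e ∈ W i)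
    (h1 : ∀ m ∈ M, ∀ i, ∀ e ∈ W i, R (ι F m) e ∈ W (i + 1)) (k : ℕ) :
    ∀ i, ∀ e ∈ W i, ∀ u ∈ rightIdealGen M ^ k, R u e ∈ W (i + k) := by
  have hstab : ∀ i, ∀ e ∈ W i, ∀ u, R u e ∈ W i := fun i e he u =>
    apply_mem_of_stable R (fun a => h0 a i) he u
  have hone : ∀ i, ∀ e ∈ W i, ∀ u ∈ rightIdealGen M, R u e ∈ W (i + 1) := by
    intro i e he u hu
    have : rightIdealGen M ≤ (W (i + 1)).comap ((LinearMap.applyₗ e) ∘ₗ R.toLinearMap) :=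
      rightIdealGen_induction fun m hm v => by
        simp only [Submodule.mem_comap, LinearMap.comp_apply, AlgHom.toLinearMap_apply,
          LinearMap.applyₗ_apply_apply, map_mul, Module.End.mul_apply]
        exact h1 m hm i _ (hstab i e he v)
    exact this hu
  induction k with
  | zero => exact fun i e he u _ => hstab i e he u
  | succ k ih =>
    intro i e he u hu
    rw [pow_succ] at hu
    induction hu using Submodule.mul_induction_on' with
    | mem_mul_mem v hv w hw =>
      rw [map_mul, Module.End.mul_apply]
      have := ih (i + 1) _ (hone i e he w hw) v hv
      rwa [add_assoc, add_comm 1] at this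
    | add v _ w _ hv hw => rw [map_add, LinearMap.add_apply]; exact add_mem hv hw

end RightIdeal

end UniversalEnvelopingAlgebra

/-! ### Semidirect products with a line -/

section SemidirectLine

variable {F L : Type*} [Field F] [LieRing L] [LieAlgebra F L] {M : LieIdeal F L} {x : L}

theorem IsSemidirectLine.exists_eq_add (hM : IsSemidirectLine M x) (a : L) :
    ∃ m : M, ∃ c : F, a = m + c • x := by
  have : a ∈ M.toSubmodule ⊔ Submodule.span F {x} := by rw [hM.2.sup_eq_top]; trivial
  obtain ⟨m, hm, z, hz, rfl⟩ := Submodule.mem_sup.1 this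
  obtain ⟨c, rfl⟩ := Submodule.mem_span_singleton.1 hz
  exact ⟨⟨m, hm⟩, c, rfl⟩

theorem IsSemidirectLine.smul (hM : IsSemidirectLine M x) {c : F} (hc : c ≠ 0) :
    IsSemidirectLine M (c • x) :=
  ⟨smul_ne_zero hc hM.1, by
    rw [Submodule.span_singleton_smul_eq (IsUnit.mk0 c hc)]; exact hM.2⟩

theorem IsSemidirectLine.exists_linearMap (hM : IsSemidirectLine M x) {G : Type*} [AddCommGroup G]
    [Module F G] (f : M →ₗ[F] G) (t : G) :
    ∃ g : L →ₗ[F] G, (∀ m : M, g m = f m) ∧ g x = t := by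
  obtain ⟨g, hg⟩ : ∃ g : L →ₗ[F] M, ∀ m : M, g m = m :=
    ⟨M.toSubmodule.projectionOnto _ hM.2, fun m =>
      Submodule.projectionOnto_apply_left hM.2 m⟩
  -- the coordinate along `x`, read off from the projection onto the line
  obtain ⟨l, hl⟩ : ∃ l : L →ₗ[F] F, (∀ m : M, l m = 0) ∧ l x = 1 := by
    have hx : x ∉ M.toSubmodule := fun h => hM.1 <| by
      have := hM.2.disjoint.le_bot ⟨h, Submodule.mem_span_singleton_self x⟩
      simpa using this
    obtain ⟨l, hl, hlM⟩ := Submodule.exists_le_ker_of_notMem hx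
    exact ⟨(l x)⁻¹ • l, fun m => by
      rw [LinearMap.smul_apply, show l m = 0 from hlM m.2, smul_zero], by simp [hl]⟩
  refine ⟨f ∘ₗ g + l.smulRight (t - f (g x)), fun m => ?_, ?_⟩
  · simp [hg, hl.1]
  · simp [hl.2]

/-- A Lie homomorphism out of `M ⋊ ⟨x⟩` is a homomorphism `f` on `M` and an image `t` for `x` that
acts on the image of `f` as `x` acts on `M`. -/
theorem IsSemidirectLine.exists_lieHom (hM : IsSemidirectLine M x) {G : Type*} [LieRing G]
    [LieAlgebra F G] (f : M →ₗ[F] G) (hf : ∀ m n, f ⁅m, n⁆ = ⁅f m, f n⁆) (t : G)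
    (ht : ∀ m : M, f ⁅x, m⁆ = ⁅t, f m⁆) :
    ∃ g : L →ₗ⁅F⁆ G, (∀ m : M, g m = f m) ∧ g x = t := by
  obtain ⟨g, hg, hgx⟩ := hM.exists_linearMap f t
  have hmn : ∀ m n : M, g ⁅(m : L), (n : L)⁆ = ⁅f m, f n⁆ := fun m n => by
    rw [← hf, ← hg]; rfl
  have hxm : ∀ m : M, g ⁅x, (m : L)⁆ = ⁅t, f m⁆ := fun m => by rw [← ht, ← hg]; rfl
  have hmx : ∀ m : M, g ⁅(m : L), x⁆ = ⁅f m, t⁆ := fun m => by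
    rw [← lie_skew, map_neg, hxm, lie_skew]
  refine ⟨{ g with map_lie' := ?_ }, hg, hgx⟩
  intro a b
  obtain ⟨m, c, rfl⟩ := hM.exists_eq_add a
  obtain ⟨n, d, rfl⟩ := hM.exists_eq_add b
  change g _ = ⁅g _, g _⁆
  simp only [add_lie, lie_add, smul_lie, lie_smul, map_add, map_smul, hmn, hxm, hmx, hg, hgx,
    lie_self, smul_zero, map_zero]

end SemidirectLine

namespace UniversalEnvelopingAlgebra

section SemidirectLine

variable {F L A : Type*} [Field F] [LieRing L] [LieAlgebra F L] {M : LieIdeal F L} {x : L}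
  [Ring A] [Algebra F A]

attribute [local instance] LieRing.ofAssociativeRing in
/-- The universal property of `U(M ⋊ ⟨x⟩)`. -/
theorem exists_algHom_of_isSemidirectLine (hM : IsSemidirectLine M x) (f : M →ₗ[F] A)
    (hf : ∀ m n, f ⁅m, n⁆ = f m * f n - f n * f m) (t : A)
    (ht : ∀ m : M, f ⁅x, m⁆ = t * f m - f m * t) :
    ∃ φ : UniversalEnvelopingAlgebra F L →ₐ[F] A, (∀ m : M, φ (ι F m) = f m) ∧ φ (ι F x) = t := by
  obtain ⟨g, hg, hgx⟩ := hM.exists_lieHom f hf t ht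
  exact ⟨lift F g, fun m => (lift_ι_apply F g m).trans (hg m), (lift_ι_apply F g x).trans hgx⟩

theorem algHom_ext_of_isSemidirectLine (hM : IsSemidirectLine M x)
    {φ ψ : UniversalEnvelopingAlgebra F L →ₐ[F] A}
    (h1 : ∀ m : M, φ (ι F m) = ψ (ι F m)) (h2 : φ (ι F x) = ψ (ι F x)) : φ = ψ := by
  refine algHom_ext_ι fun a => ?_
  obtain ⟨m, c, rfl⟩ := hM.exists_eq_add a
  rw [map_add, map_smul, map_add, map_smul, map_add, map_smul, h1, h2]

/-- Since `U(L) / M U(L)` is generated by the class of `x`, every element of `U(L)` is a polynomial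
in `x` modulo `M U(L)`. The polynomial is the value of a homomorphism `π` to `F[X]`. -/
theorem exists_algHom_polynomial (hM : IsSemidirectLine M x) :
    ∃ π : UniversalEnvelopingAlgebra F L →ₐ[F] Polynomial F, π (ι F x) = Polynomial.X ∧
      (∀ u, π u = 0 ↔ u ∈ rightIdealGen M) ∧
      ∀ u, u - Polynomial.aeval (ι F x) (π u) ∈ rightIdealGen M := by
  obtain ⟨π, hπM, hπx⟩ := exists_algHom_of_isSemidirectLine hM (A := Polynomial F) 0 (by simp)
    Polynomial.X (by simp)
  have hker : rightIdealGen M ≤ LinearMap.ker π.toLinearMap :=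
    rightIdealGen_induction fun m hm u => by
      have := hπM ⟨m, hm⟩
      simp only [LinearMap.zero_apply] at this
      rw [LinearMap.mem_ker, AlgHom.toLinearMap_apply, map_mul, this, zero_mul]
  have hmod : ∀ u, u - Polynomial.aeval (ι F x) (π u) ∈ rightIdealGen M := by
    intro u
    refine induction_left ((rightIdealGen M).comap
      (LinearMap.id - (Polynomial.aeval (ι F x)).toLinearMap ∘ₗ π.toLinearMap)) ?_ ?_ u
    · simp
    · intro a v hv
      simp only [Submodule.mem_comap, LinearMap.sub_apply, LinearMap.id_apply,
        LinearMap.comp_apply, AlgHom.toLinearMap_apply] at hv ⊢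
      obtain ⟨m, c, rfl⟩ := hM.exists_eq_add a
      have : ι F (m + c • x) * v - Polynomial.aeval (ι F x) (π (ι F (m + c • x) * v)) =
          ι F (m : L) * v + c • (ι F x * (v - Polynomial.aeval (ι F x) (π v))) := by
        rw [map_add, map_smul, add_mul, map_add, map_mul, map_mul, map_smul, hπx, hπM,
          LinearMap.zero_apply, zero_mul, zero_add, smul_mul_assoc, smul_mul_assoc, map_smul,
          map_mul, Polynomial.aeval_X, mul_sub, smul_sub, add_sub_assoc]
      rw [this]
      exact add_mem (mul_mem_rightIdealGen m.2 v)
        (Submodule.smul_mem _ _ (mul_mem_rightIdealGen_left hv _))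
  refine ⟨π, hπx, fun u => ⟨fun h => ?_, fun h => hker h⟩, hmod⟩
  have := hmod u
  rwa [h, map_zero, sub_zero] at this

end SemidirectLine

/-! ### Normal ordering: `U(M ⋊ ⟨x⟩)` as polynomials in `x` over `U(M)` -/

section NormalOrdering

variable {F L : Type*} [Field F] [LieRing L] [LieAlgebra F L] {M : LieIdeal F L} {x : L}

/-- Writing elements of `U(L)` with the powers of `x` on the right embeds `U(L)`, as a left
`U(M)`-module, in the polynomials over `U(M)`, encoded as finitely supported sequences of
coefficients. The constant coefficient is a retraction to `U(M)` that kills `U(L) x`, and the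
coefficients of `(M U(L))ᵏ` lie in the `k`-th power of the augmentation ideal of `U(M)`. -/
theorem exists_normalOrdering (hM : IsSemidirectLine M x) :
    ∃ Ψ : UniversalEnvelopingAlgebra F L →ₗ[F] (ℕ →₀ UniversalEnvelopingAlgebra F M),
      Function.Injective Ψ ∧ Ψ 1 = Finsupp.single 0 1 ∧
      (∀ (m : M) u i, Ψ (ι F (m : L) * u) i = ι F m * Ψ u i) ∧
      (∀ u, Ψ (u * ι F x) 0 = 0) ∧
      ∀ k, ∀ u ∈ rightIdealGen M ^ (k + 1), ∀ i,
        Ψ u i ∈ rightIdealGen (⊤ : LieIdeal F M) ^ (k + 1) := by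
  obtain ⟨δ, hδι, hδ⟩ := exists_derivation (F := F) (K := M)
    (LieModule.toEnd F L M x : M →ₗ[F] M) (fun a b =>
      Subtype.ext (leibniz_lie x (a : L) (b : L)))
  simp only [LieModule.toEnd_apply_apply] at hδι
  have hδ1 : δ 1 = 0 := by simpa using hδ 1 1
  -- `U(L)` acts on polynomials over `U(M)`: `M` by left multiplication, `x` by `δ + X`
  let lm : M →ₗ[F] Module.End F (ℕ →₀ UniversalEnvelopingAlgebra F M) :=
    { toFun := fun m => Finsupp.mapRange.linearMap (LinearMap.mulLeft F (ι F m))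
      map_add' := fun a b => by ext; simp [-ι_apply, add_mul]
      map_smul' := fun r a => LinearMap.ext fun p => Finsupp.ext fun i => by
        change ι F (r • a) * p i = r • (ι F a * p i)
        rw [map_smul, smul_mul_assoc] }
  have hlm : ∀ m p i, lm m p i = ι F m * p i := fun m p i => rfl
  let T : Module.End F (ℕ →₀ UniversalEnvelopingAlgebra F M) :=
    Finsupp.mapRange.linearMap δ + Finsupp.lmapDomain _ F Nat.succ
  have hT : ∀ i u, T (Finsupp.single i u) = Finsupp.single i (δ u) + Finsupp.single (i + 1) u := by
    intro i u; simp [T]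
  have hT0 : ∀ p, T p 0 = δ (p 0) := by
    intro p
    simp only [T, LinearMap.add_apply, Finsupp.add_apply, Finsupp.mapRange.linearMap_apply,
      Finsupp.mapRange_apply, Finsupp.lmapDomain_apply]
    rw [Finsupp.mapDomain_of_notMem_range _ _ (by simp), add_zero]
  have hTs : ∀ p i, T p (i + 1) = δ (p (i + 1)) + p i := by
    intro p i
    simp only [T, LinearMap.add_apply, Finsupp.add_apply, Finsupp.mapRange.linearMap_apply,
      Finsupp.mapRange_apply, Finsupp.lmapDomain_apply]
    exact congrArg _ (Finsupp.mapDomain_apply Nat.succ_injective p i)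
  obtain ⟨R, hRM, hRx⟩ := exists_algHom_of_isSemidirectLine hM lm (fun m n => by
      ext p q : 2
      ext j : 1
      simp only [LinearMap.comp_apply, LinearMap.sub_apply, Module.End.mul_apply,
        Finsupp.sub_apply, hlm, ι_lie, sub_mul, mul_assoc]) T (fun m => by
      ext p q : 2
      ext j : 1
      rcases j with _ | j <;>
      · simp only [LinearMap.comp_apply, LinearMap.sub_apply, Module.End.mul_apply,
          Finsupp.sub_apply, hlm, hT0, hTs, hδ, hδι, mul_add]
        abel)
  let Ψ : UniversalEnvelopingAlgebra F L →ₗ[F] (ℕ →₀ UniversalEnvelopingAlgebra F M) :=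
    LinearMap.applyₗ (Finsupp.single 0 1) ∘ₗ R.toLinearMap
  have hΨ : ∀ u, Ψ u = R u (Finsupp.single 0 1) := fun u => rfl
  -- substitution of `x` for the variable inverts the normal ordering
  obtain ⟨j, hj⟩ := exists_algHom (F := F) (K := M) (ιₗ F L ∘ₗ M.toSubmodule.subtype)
    (fun a b => ι_lie (a : L) (b : L))
  have hj' : ∀ m : M, j (ι F m) = ι F (m : L) := hj
  have hjδ : ∀ u, j (δ u) = ι F x * j u - j u * ι F x := by
    intro u
    refine induction_left (LinearMap.ker (j.toLinearMap ∘ₗ δ -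
      (LinearMap.mulLeft F (ι F x) - LinearMap.mulRight F (ι F x)) ∘ₗ j.toLinearMap))
      (by simp [hδ1]) (fun m v hv => ?_) u |> fun h => by simpa [sub_eq_zero, -ι_apply] using h
    have hv' : j (δ v) = ι F x * j v - j v * ι F x := by simpa [sub_eq_zero, -ι_apply] using hv
    have hm : ι F ((⁅x, m⁆ : M) : L) = ι F x * ι F (m : L) - ι F (m : L) * ι F x := ι_lie _ _
    simp only [LinearMap.mem_ker, LinearMap.sub_apply, LinearMap.comp_apply,
      AlgHom.toLinearMap_apply, LinearMap.mulLeft_apply, LinearMap.mulRight_apply, hδ, map_add,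
      map_mul, hδι, hj', hm, hv']
    noncomm_ring
  let Θ : (ℕ →₀ UniversalEnvelopingAlgebra F M) →ₗ[F] UniversalEnvelopingAlgebra F L :=
    Finsupp.lsum F fun i => LinearMap.mulRight F (ι F x ^ i) ∘ₗ j.toLinearMap
  have hΘ : ∀ i u, Θ (Finsupp.single i u) = j u * ι F x ^ i := by
    intro i u; simp [Θ]
  have hΘx : Θ ∘ₗ T = LinearMap.mulLeft F (ι F x) ∘ₗ Θ := by
    ext i u
    simp only [LinearMap.comp_apply, Finsupp.lsingle_apply, hT, map_add, hΘ, hjδ,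
      LinearMap.mulLeft_apply, pow_succ']
    noncomm_ring
  have hΘM : ∀ m, Θ ∘ₗ lm m = LinearMap.mulLeft F (ι F (m : L)) ∘ₗ Θ := by
    intro m
    ext i u
    have : lm m (Finsupp.single i u) = Finsupp.single i (ι F m * u) := by simp [lm, -ι_apply]
    simp only [LinearMap.comp_apply, Finsupp.lsingle_apply, this, hΘ, hj', map_mul,
      LinearMap.mulLeft_apply, mul_assoc]
  have hΘΨ : ∀ u, Θ (Ψ u) = u := by
    intro u
    refine induction_left (LinearMap.ker (Θ ∘ₗ Ψ - LinearMap.id)) ?_ (fun a v hv => ?_) u |>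
      fun h => by simpa [sub_eq_zero] using h
    · simp [hΨ, hΘ]
    · have hv' : Θ (R v (Finsupp.single 0 1)) = v := by simpa [sub_eq_zero, hΨ] using hv
      obtain ⟨m, c, rfl⟩ := hM.exists_eq_add a
      have h1 := fun p => LinearMap.congr_fun hΘx p
      have h2 := fun p => LinearMap.congr_fun (hΘM m) p
      simp only [LinearMap.comp_apply, LinearMap.mulLeft_apply] at h1 h2
      simp only [LinearMap.mem_ker, LinearMap.sub_apply, LinearMap.comp_apply, hΨ,
        LinearMap.id_apply, map_add, map_smul, map_mul, hRM, hRx, add_mul, smul_mul_assoc,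
        Module.End.mul_apply, h1, h2, hv', sub_self, smul_zero,
        add_zero]
  refine ⟨Ψ, Function.LeftInverse.injective hΘΨ, by simp [hΨ], fun m u i => ?_, fun u => ?_,
    fun k u hu i => ?_⟩
  · rw [hΨ, map_mul, hRM, Module.End.mul_apply, hlm]
    rfl
  · rw [hΨ, map_mul, hRx, Module.End.mul_apply, hT, hδ1, Finsupp.single_zero, zero_add]
    -- multiples of the variable form a subrepresentation
    exact apply_mem_of_stable R (W := LinearMap.ker (Finsupp.lapply (R := F) (0 : ℕ) :
        (ℕ →₀ UniversalEnvelopingAlgebra F M) →ₗ[F] _))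
      (fun a e he => by
        simp only [LinearMap.mem_ker, Finsupp.lapply_apply] at he ⊢
        obtain ⟨m, c, rfl⟩ := hM.exists_eq_add a
        simp [-ι_apply, hRM, hRx, hlm, hT0, he])
      (e := Finsupp.single 1 1) (by simp) u
  · have hδω : ∀ k, ∀ u ∈ rightIdealGen (⊤ : LieIdeal F M) ^ k,
        δ u ∈ rightIdealGen (⊤ : LieIdeal F M) ^ k := by
      intro k
      induction k with
      | zero =>
        intro u hu
        rw [pow_zero, Submodule.mem_one] at hu
        obtain ⟨r, rfl⟩ := hu
        rw [Algebra.algebraMap_eq_smul_one, map_smul, hδ1, smul_zero]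
        exact zero_mem _
      | succ k ih =>
        have h1 : rightIdealGen (⊤ : LieIdeal F M) ≤ (rightIdealGen (⊤ : LieIdeal F M)).comap δ :=
          rightIdealGen_induction fun m _ u => by
            simp only [Submodule.mem_comap, hδ, hδι]
            exact add_mem (mul_mem_rightIdealGen (LieSubmodule.mem_top _) _) (mul_mem_rightIdealGen (LieSubmodule.mem_top _) _)
        intro u hu
        rw [pow_succ] at hu ⊢
        induction hu using Submodule.mul_induction_on' with
        | mem_mul_mem v hv w hw =>
          rw [hδ]
          exact add_mem (Submodule.mul_mem_mul (ih v hv) hw) (Submodule.mul_mem_mul hv (h1 hw))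
        | add v _ w _ hv hw => rw [map_add]; exact add_mem hv hw
    have hδω' : ∀ k, ∀ u ∈ rightIdealGen (⊤ : LieIdeal F M) ^ k * ⊤,
        δ u ∈ rightIdealGen (⊤ : LieIdeal F M) ^ k * ⊤ := by
      intro k u hu
      cases k with
      | zero => simp
      | succ k => rw [rightIdealGen_pow_succ_mul_top] at hu ⊢; exact hδω _ u hu
    have hR := apply_mem_of_mem_rightIdealGen_pow (M := M) R
      (fun k => ⨅ i, (rightIdealGen (⊤ : LieIdeal F M) ^ k * ⊤).comap (Finsupp.lapply i))
      (fun a k e he => by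
        simp only [Submodule.mem_iInf, Submodule.mem_comap, Finsupp.lapply_apply] at he ⊢
        intro i
        obtain ⟨m, c, rfl⟩ := hM.exists_eq_add a
        rw [map_add, map_smul, map_add, map_smul, hRM, hRx, LinearMap.add_apply,
          LinearMap.smul_apply, Finsupp.add_apply, Finsupp.smul_apply, hlm]
        refine add_mem (top_mul_rightIdealGen_pow_mul_top k
          (Submodule.mul_mem_mul Submodule.mem_top (he i))) (Submodule.smul_mem _ _ ?_)
        cases i with
        | zero => rw [hT0]; exact hδω' k _ (he 0)
        | succ i => rw [hTs]; exact add_mem (hδω' k _ (he _)) (he i))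
      (fun m hm k e he => by
        simp only [Submodule.mem_iInf, Submodule.mem_comap, Finsupp.lapply_apply] at he ⊢
        intro i
        rw [hRM ⟨m, hm⟩, hlm, pow_succ', mul_assoc]
        exact Submodule.mul_mem_mul (ι_mem_rightIdealGen (LieSubmodule.mem_top _)) (he i))
      (k + 1) 0 (Finsupp.single 0 1) (by simp) u hu
    simp only [Submodule.mem_iInf, Submodule.mem_comap, Finsupp.lapply_apply, zero_add,
      rightIdealGen_pow_succ_mul_top] at hR
    exact hR i

end NormalOrdering

/-! ### Powers of the augmentation ideal -/

section Augmentation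

variable {F K P Q : Type*} [Field F] [LieRing K] [LieAlgebra F K] [AddCommGroup P] [Module F P]
  [AddCommGroup Q] [Module F Q]

/-- Linear functions on `U(K)` that vanish on the square, respectively the cube, of the
augmentation ideal, with prescribed values on `K` and on products of two elements of `K`. They
are read off from the representation of `K` on `F × P × Q` in which `k` sends `1` to `(p k, s k)`
and `p' ∈ P` to `f (p k) p' ∈ Q`. -/
theorem exists_linearMap_truncated (p : K →ₗ[F] P) (s : K →ₗ[F] Q) (f : P →ₗ[F] P →ₗ[F] Q)
    (hp : ∀ a b : K, p ⁅a, b⁆ = 0) (hs : ∀ a b : K, s ⁅a, b⁆ = f (p a) (p b) - f (p b) (p a)) :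
    ∃ (t₁ : UniversalEnvelopingAlgebra F K →ₗ[F] P) (t₂ : UniversalEnvelopingAlgebra F K →ₗ[F] Q),
      (∀ a, t₁ (ι F a) = p a) ∧ (∀ u ∈ rightIdealGen (⊤ : LieIdeal F K) ^ 2, t₁ u = 0) ∧
      (∀ a, t₂ (ι F a) = s a) ∧ (∀ a b, t₂ (ι F a * ι F b) = f (p a) (p b)) ∧
      ∀ u ∈ rightIdealGen (⊤ : LieIdeal F K) ^ 3, t₂ u = 0 := by
  let r : K →ₗ[F] Module.End F (F × P × Q) :=
    { toFun := fun a =>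
        { toFun := fun e => (0, e.1 • p a, e.1 • s a + f (p a) e.2.1)
          map_add' := fun e e' => by
            ext <;> simp [add_smul]; abel
          map_smul' := fun c e => by ext <;> simp [mul_smul] }
      map_add' := fun a b => LinearMap.ext fun e => by
        simp only [LinearMap.coe_mk, AddHom.coe_mk, LinearMap.add_apply, map_add, smul_add,
          Prod.mk_add_mk, add_zero]
        congr 2; abel
      map_smul' := fun c a => LinearMap.ext fun e => by
        simp [smul_comm c] }
  have hr : ∀ a e, r a e = (0, e.1 • p a, e.1 • s a + f (p a) e.2.1) := fun a e => rfl
  obtain ⟨R, hR⟩ := exists_algHom r (fun a b => LinearMap.ext fun e => by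
    rw [LinearMap.sub_apply, Module.End.mul_apply, Module.End.mul_apply]
    simp only [hr, hp, hs, smul_zero, zero_smul, zero_add, map_smul, smul_sub, Prod.mk_sub_mk,
      sub_self, map_zero, LinearMap.zero_apply, add_zero])
  -- the filtration `F × P × Q ⊇ P × Q ⊇ Q ⊇ 0`
  let W : ℕ → Submodule F (F × P × Q) := fun
    | 0 => ⊤
    | 1 => LinearMap.ker (LinearMap.fst F F (P × Q))
    | 2 => LinearMap.ker (LinearMap.fst F F (P × Q)) ⊓
        LinearMap.ker (LinearMap.fst F P Q ∘ₗ LinearMap.snd F F (P × Q))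
    | _ => ⊥
  have hW : ∀ a i, ∀ e ∈ W i, R (ι F a) e ∈ W (i + 1) := by
    intro a i e he
    rw [hR, hr]
    match i with
    | 0 => simp [W]
    | 1 => simp [W] at he ⊢; simp [he]
    | 2 => simp [W] at he ⊢; simp [he]
    | i + 3 => simp [W] at he ⊢; simp [he]
  have hle : ∀ i, W (i + 1) ≤ W i := by
    intro i
    match i with
    | 0 => exact le_top
    | 1 => exact inf_le_left
    | 2 => exact bot_le
    | i + 3 => exact bot_le
  have hpow := fun k => apply_mem_of_mem_rightIdealGen_pow (M := (⊤ : LieIdeal F K)) R W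
    (fun a i e he => hle i (hW a i e he)) (fun a _ => hW a) k 0 (1, 0, 0) (by simp [W])
  refine ⟨LinearMap.fst F P Q ∘ₗ LinearMap.snd F F (P × Q) ∘ₗ LinearMap.applyₗ (1, 0, 0) ∘ₗ
      R.toLinearMap, LinearMap.snd F P Q ∘ₗ LinearMap.snd F F (P × Q) ∘ₗ
      LinearMap.applyₗ (1, 0, 0) ∘ₗ R.toLinearMap, fun a => ?_, fun u hu => ?_, fun a => ?_,
      fun a b => ?_, fun u hu => ?_⟩
  · simp [-ι_apply, hR, hr]
  · have := hpow 2 u hu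
    simp only [W, Submodule.mem_inf] at this
    exact this.2
  · simp [-ι_apply, hR, hr]
  · simp [-ι_apply, hR, hr]
  · have := hpow 3 u hu
    simp only [W, Submodule.mem_bot] at this
    simp [this]

/-- Over every field, including characteristic two, an alternating form is the difference of a
bilinear form and its transpose. -/
theorem exists_bilin_sub_flip {V : Type*} [AddCommGroup V] [Module F V]
    (b : V →ₗ[F] V →ₗ[F] F) (hb : ∀ v, b v v = 0) :
    ∃ f : V →ₗ[F] V →ₗ[F] F, ∀ v w, f v w - f w v = b v w := by
  classical
  let B := Module.Free.chooseBasis F V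
  let : LinearOrder (Module.Free.ChooseBasisIndex F V) := linearOrderOfSTO WellOrderingRel
  -- the strictly upper triangular part of the matrix of `b`
  let f : V →ₗ[F] V →ₗ[F] F := B.constr F fun i => B.constr F fun j =>
    if i < j then b (B i) (B j) else 0
  have hf : ∀ i j, f (B i) (B j) = if i < j then b (B i) (B j) else 0 := fun i j => by
    simp [f]
  have hskew : ∀ v w, b v w = - b w v := fun v w => by
    have := hb (v + w)
    simp only [map_add, LinearMap.add_apply, hb, zero_add, add_zero] at this
    exact eq_neg_of_add_eq_zero_right this
  have : f - f.flip = b := by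
    refine B.ext fun i => B.ext fun j => ?_
    simp only [LinearMap.sub_apply, LinearMap.flip_apply, hf]
    rcases lt_trichotomy i j with h | h | h
    · simp [h, h.not_gt]
    · simp [h, hb]
    · simp [h, h.not_gt, hskew (B i)]
  exact ⟨f, fun v w => by rw [← this]; simp⟩

/-- An element of `K` in the cube of the augmentation ideal of `U(K)` lies in
`[K, [K, K]]`. -/
theorem mem_lowerCentralSeries_two_of_ι_mem_pow_three {z : K}
    (hz : ι F z ∈ rightIdealGen (⊤ : LieIdeal F K) ^ 3) :
    z ∈ LieModule.lowerCentralSeries F K K 2 := by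
  by_contra hzn
  obtain ⟨l, hlz, hl⟩ := Submodule.exists_le_ker_of_notMem
    (p := (LieModule.lowerCentralSeries F K K 2).toSubmodule) hzn
  have hlie1 : ∀ a b : K, ⁅a, b⁆ ∈ LieModule.lowerCentralSeries F K K 1 := fun a b =>
    LieSubmodule.lie_mem_lie (LieSubmodule.mem_top a) (LieSubmodule.mem_top b)
  have hlie2 : ∀ a, ∀ b ∈ LieModule.lowerCentralSeries F K K 1, l ⁅a, b⁆ = 0 := fun a b hb =>
    hl (LieSubmodule.lie_mem_lie (LieSubmodule.mem_top a) hb)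
  -- a projection `p` with kernel `[K, K]`
  obtain ⟨C, hC⟩ := Submodule.exists_isCompl (LieModule.lowerCentralSeries F K K 1).toSubmodule
  obtain ⟨p, hp, hp'⟩ : ∃ p : K →ₗ[F] K,
      (∀ a ∈ LieModule.lowerCentralSeries F K K 1, p a = 0) ∧
      ∀ a, a - p a ∈ LieModule.lowerCentralSeries F K K 1 := by
    refine ⟨LinearMap.id - (LieModule.lowerCentralSeries F K K 1).toSubmodule.subtype ∘ₗ
      Submodule.projectionOnto _ C hC, fun a ha => ?_, fun a => ?_⟩
    · have := Submodule.projectionOnto_apply_left hC ⟨a, ha⟩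
      simp only [LinearMap.sub_apply, LinearMap.id_apply, LinearMap.comp_apply, this,
        Submodule.subtype_apply, sub_self]
    · change a - (a - (Submodule.projectionOnto _ C hC a : K)) ∈ _
      rw [sub_sub_cancel]
      exact (Submodule.projectionOnto _ C hC a).2
  -- the form `l ⁅a, c⁆` depends only on `p a` and `p c`, so `l` extends to a function on `U(K)`
  -- that vanishes on the cube of the augmentation ideal
  let b : K →ₗ[F] K →ₗ[F] F := (LieModule.toEnd F K K : K →ₗ[F] Module.End F K).compr₂ l
  have hb : ∀ a c, b a c = l ⁅a, c⁆ := fun a c => rfl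
  obtain ⟨f, hf⟩ := exists_bilin_sub_flip b (fun v => by simp [hb])
  obtain ⟨-, t, -, -, ht, -, ht3⟩ := exists_linearMap_truncated p l f
    (fun a c => hp _ (hlie1 a c)) (fun a c => by
      rw [hf, hb]
      have h1 : ⁅a, c⁆ = ⁅p a, p c⁆ + ⁅p a, c - p c⁆ - ⁅c, a - p a⁆ := by
        rw [lie_sub, lie_sub, ← lie_skew c a, ← lie_skew c (p a)]; abel
      rw [h1, map_sub, map_add, hlie2 _ _ (hp' c), hlie2 _ _ (hp' a), add_zero, sub_zero])
  exact hlz (by rw [← ht, ht3 _ hz])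

/-- The augmentation ideal of the enveloping algebra of an abelian Lie algebra, which is a
polynomial ring, is separated. -/
theorem eq_zero_of_forall_mem_pow (hK : ∀ a b : K, ⁅a, b⁆ = 0)
    {u : UniversalEnvelopingAlgebra F K}
    (hu : ∀ k, u ∈ rightIdealGen (⊤ : LieIdeal F K) ^ (k + 1)) : u = 0 := by
  classical
  have hcomm : ∀ v w : UniversalEnvelopingAlgebra F K, v * w = w * v := by
    have h1 : ∀ (a : K) (w : UniversalEnvelopingAlgebra F K), ι F a * w = w * ι F a := by
      intro a w
      have := induction_left (LinearMap.ker (LinearMap.mulLeft F (ι F a) -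
        LinearMap.mulRight F (ι F a))) (by simp) (fun b v hv => by
          have hv' : ι F a * v = v * ι F a := by simpa [sub_eq_zero, -ι_apply] using hv
          have hab : ι F a * ι F b = ι F b * ι F a := by
            rw [← sub_eq_zero, ← ι_lie, hK, map_zero]
          simp only [LinearMap.mem_ker, LinearMap.sub_apply, LinearMap.mulLeft_apply,
            LinearMap.mulRight_apply, sub_eq_zero]
          rw [← mul_assoc, hab, mul_assoc, hv', mul_assoc]) w
      simpa [sub_eq_zero, -ι_apply] using this
    intro v w
    have := induction_left (LinearMap.ker (LinearMap.mulLeft F w -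
        LinearMap.mulRight F w)) (by simp) (fun b v hv => by
          have hv' : w * v = v * w := by simpa [sub_eq_zero] using hv
          simp only [LinearMap.mem_ker, LinearMap.sub_apply, LinearMap.mulLeft_apply,
            LinearMap.mulRight_apply, sub_eq_zero]
          rw [← mul_assoc, ← h1, mul_assoc, hv', mul_assoc]) v
    have h : w * v = v * w := by simpa [sub_eq_zero] using this
    exact h.symm
  let B := Module.Free.chooseBasis F K
  let g : K →ₗ[F] MvPolynomial (Module.Free.ChooseBasisIndex F K) F :=
    B.constr F fun i => MvPolynomial.X i
  have hg : ∀ a, g a ∈ MvPolynomial.idealOfVars (Module.Free.ChooseBasisIndex F K) F := by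
    intro a
    have : (⊤ : Submodule F K) ≤
        ((MvPolynomial.idealOfVars (Module.Free.ChooseBasisIndex F K) F).restrictScalars F).comap
          g := by
      rw [← B.span_eq, Submodule.span_le]
      rintro _ ⟨i, rfl⟩
      simp only [Submodule.comap_coe, Set.mem_preimage, g, B.constr_basis]
      exact Ideal.subset_span ⟨i, rfl⟩
    exact this Submodule.mem_top
  obtain ⟨φ, hφ⟩ := exists_algHom g (fun a b => by rw [hK, map_zero, mul_comm, sub_self])
  have hφinj : Function.Injective φ := by
    let : CommRing (UniversalEnvelopingAlgebra F K) :=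
      { (inferInstance : Ring (UniversalEnvelopingAlgebra F K)) with mul_comm := hcomm }
    let ψ : MvPolynomial (Module.Free.ChooseBasisIndex F K) F →ₐ[F]
      UniversalEnvelopingAlgebra F K := MvPolynomial.aeval fun i => ι F (B i)
    have : ψ.comp φ = AlgHom.id F _ := algHom_ext_ι fun a => by
      have h : ψ.toLinearMap ∘ₗ g = ιₗ F K := B.ext fun i => by simp [g, ψ, ιₗ_apply, -ι_apply]
      rw [AlgHom.comp_apply, hφ]
      exact LinearMap.congr_fun h a
    exact Function.LeftInverse.injective (g := ψ) fun v => DFunLike.congr_fun this v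
  have hpow : ∀ k, ∀ v ∈ rightIdealGen (⊤ : LieIdeal F K) ^ (k + 1),
      φ v ∈ MvPolynomial.idealOfVars (Module.Free.ChooseBasisIndex F K) F ^ (k + 1) := by
    have h1 : ∀ v ∈ rightIdealGen (⊤ : LieIdeal F K),
        φ v ∈ MvPolynomial.idealOfVars (Module.Free.ChooseBasisIndex F K) F := by
      have : rightIdealGen (⊤ : LieIdeal F K) ≤ ((MvPolynomial.idealOfVars
          (Module.Free.ChooseBasisIndex F K) F).restrictScalars F).comap φ.toLinearMap :=
        rightIdealGen_induction fun a _ v => by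
          simp only [Submodule.mem_comap, AlgHom.toLinearMap_apply, map_mul, hφ]
          exact Ideal.mul_mem_right _ _ (hg a)
      exact this
    intro k
    induction k with
    | zero => simpa using h1
    | succ k ih =>
      intro v hv
      rw [pow_succ] at hv ⊢
      induction hv using Submodule.mul_induction_on' with
      | mem_mul_mem v hv w hw => rw [map_mul]; exact Ideal.mul_mem_mul (ih v hv) (h1 w hw)
      | add v _ w _ hv hw => rw [map_add]; exact add_mem hv hw
  apply hφinj
  rw [map_zero]
  by_contra hne
  obtain ⟨d, hd⟩ := MvPolynomial.support_nonempty.2 hne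
  have := (MvPolynomial.mem_pow_idealOfVars_iff _ _).1 (hpow d.degree u (hu _)) d hd
  omega

end Augmentation

/-! ### The layers of the filtration by powers of `M U(L)` -/

section Layer

variable {F L : Type*} [Field F] [LieRing L] [LieAlgebra F L] {M : LieIdeal F L} {x : L}

/-- The subspace `Jᵏ⁺¹ + Jᵏ x`, where `J = M U(L)`. The quotient of `Jᵏ` by it is the `k`-th layer
`Jᵏ / Jᵏ⁺¹`, a right module over `U(L) / J = F[x]`, with `x` set to zero. -/
def layerSubspace (M : LieIdeal F L) (x : L) (k : ℕ) :
    Submodule F (UniversalEnvelopingAlgebra F L) :=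
  rightIdealGen M ^ (k + 1) ⊔ rightIdealGen M ^ k * Submodule.span F {ι F x}

theorem top_le_one_sup (hM : IsSemidirectLine M x) :
    (⊤ : Submodule F (UniversalEnvelopingAlgebra F L)) ≤
      1 ⊔ (⊤ * Submodule.span F {ι F x} ⊔ rightIdealGen M) := by
  obtain ⟨π, -, -, hπ⟩ := exists_algHom_polynomial hM
  intro u _
  have h : u = algebraMap F _ ((π u).coeff 0) +
      (Polynomial.aeval (ι F x) (π u).divX * ι F x +
        (u - Polynomial.aeval (ι F x) (π u))) := by
    conv_lhs => rw [← sub_add_cancel u (Polynomial.aeval (ι F x) (π u))]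
    nth_rewrite 2 [← Polynomial.divX_mul_X_add (π u)]
    rw [map_add, map_mul, Polynomial.aeval_X, Polynomial.aeval_C]
    abel
  rw [h]
  exact Submodule.add_mem_sup (Submodule.algebraMap_mem _) (Submodule.add_mem_sup
    (Submodule.mul_mem_mul Submodule.mem_top (Submodule.mem_span_singleton_self _)) (hπ u))

theorem rightIdealGen_le_sup_layerSubspace (hM : IsSemidirectLine M x) :
    rightIdealGen M ≤ M.toSubmodule.map (ιₗ F L) ⊔ layerSubspace M x 1 := by
  conv_lhs => rw [rightIdealGen_eq_mul_top]
  refine (mul_le_mul' le_rfl (top_le_one_sup hM)).trans ?_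
  rw [Submodule.mul_sup, Submodule.mul_sup, mul_one, ← mul_assoc, ← rightIdealGen_eq_mul_top]
  refine sup_le_sup_left ?_ _
  rw [layerSubspace, pow_one, sup_comm, pow_succ, pow_one]
  refine sup_le_sup_right (mul_le_mul' ?_ le_rfl) _
  rintro _ ⟨m, hm, rfl⟩
  exact ι_mem_rightIdealGen hm

theorem rightIdealGen_sq_le_sup_layerSubspace (hM : IsSemidirectLine M x) :
    rightIdealGen M ^ 2 ≤
      M.toSubmodule.map (ιₗ F L) * M.toSubmodule.map (ιₗ F L) ⊔ layerSubspace M x 2 := by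
  have hle : M.toSubmodule.map (ιₗ F L) ≤ rightIdealGen M := by
    rintro _ ⟨m, hm, rfl⟩
    exact ι_mem_rightIdealGen hm
  have h : rightIdealGen M ^ 2 ≤ M.toSubmodule.map (ιₗ F L) * rightIdealGen M := by
    rw [sq]
    conv_lhs => rw [rightIdealGen_eq_mul_top (M := M), mul_assoc, ← rightIdealGen_eq_mul_top,
      top_mul_rightIdealGen]
  refine h.trans ((mul_le_mul' le_rfl (rightIdealGen_le_sup_layerSubspace hM)).trans ?_)
  rw [Submodule.mul_sup]
  refine sup_le_sup_left ((mul_le_mul' hle le_rfl).trans ?_) _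
  rw [layerSubspace, layerSubspace, Submodule.mul_sup, ← mul_assoc, ← pow_succ', ← pow_succ']

theorem rightIdealGen_pow_succ_le_layerSubspace (k : ℕ) :
    rightIdealGen M ^ (k + 1) ≤ layerSubspace M x k := le_sup_left

/-- A linear retraction of `U(L)` to `U(M)` that takes `Jᵏ⁺¹ + Jᵏ x` to the power `k + 1` of the
augmentation ideal: the constant coefficient of the normal ordering. -/
theorem exists_retraction (hM : IsSemidirectLine M x) :
    ∃ ε : UniversalEnvelopingAlgebra F L →ₗ[F] UniversalEnvelopingAlgebra F M,
      (∀ a : M, ε (ι F (a : L)) = ι F a) ∧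
      (∀ a b : M, ε (ι F (a : L) * ι F (b : L)) = ι F a * ι F b) ∧
      ∀ k, ∀ u ∈ layerSubspace M x k, ε u ∈ rightIdealGen (⊤ : LieIdeal F M) ^ (k + 1) := by
  obtain ⟨Ψ, -, hΨ1, hΨM, hΨx, hΨJ⟩ := exists_normalOrdering hM
  have hΨι : ∀ a : M, Ψ (ι F (a : L)) 0 = ι F a := fun a => by
    have := hΨM a 1 0
    rwa [mul_one, hΨ1, Finsupp.single_eq_same, mul_one] at this
  refine ⟨Finsupp.lapply 0 ∘ₗ Ψ, hΨι, fun a b => ?_, fun k => ?_⟩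
  · simp only [LinearMap.comp_apply, Finsupp.lapply_apply, hΨM, hΨι]
  · have : layerSubspace M x k ≤ (rightIdealGen (⊤ : LieIdeal F M) ^ (k + 1)).comap
        (Finsupp.lapply 0 ∘ₗ Ψ) := by
      refine sup_le (fun u hu => hΨJ k u hu 0) (Submodule.mul_le.2 fun u _ v hv => ?_)
      obtain ⟨c, rfl⟩ := Submodule.mem_span_singleton.1 hv
      rw [mul_smul_comm]
      refine Submodule.smul_mem _ _ ?_
      simp only [Submodule.mem_comap, LinearMap.comp_apply, Finsupp.lapply_apply, hΨx, zero_mem]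
    exact this

/-- Linear functions on `U(L)` that detect the first two layers. -/
theorem exists_linearMap_layerSubspace {P Q : Type*} [AddCommGroup P] [Module F P]
    [AddCommGroup Q] [Module F Q] (hM : IsSemidirectLine M x) (p : M →ₗ[F] P)
    (f : P →ₗ[F] P →ₗ[F] Q) (hp : ∀ a b : M, p ⁅a, b⁆ = 0)
    (hf : ∀ a b : M, f (p a) (p b) = f (p b) (p a)) :
    ∃ (t₁ : UniversalEnvelopingAlgebra F L →ₗ[F] P) (t₂ : UniversalEnvelopingAlgebra F L →ₗ[F] Q),
      (∀ a : M, t₁ (ι F (a : L)) = p a) ∧ (∀ u ∈ layerSubspace M x 1, t₁ u = 0) ∧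
      (∀ a b : M, t₂ (ι F (a : L) * ι F (b : L)) = f (p a) (p b)) ∧
      ∀ u ∈ layerSubspace M x 2, t₂ u = 0 := by
  obtain ⟨ε, hε, hε2, hεk⟩ := exists_retraction hM
  obtain ⟨t₁, t₂, h1, h1', -, h2, h2'⟩ := exists_linearMap_truncated p (0 : M →ₗ[F] Q) f hp
    (fun a b => by rw [hf, sub_self, LinearMap.zero_apply])
  refine ⟨t₁ ∘ₗ ε, t₂ ∘ₗ ε, fun a => ?_, fun u hu => h1' _ (hεk 1 u hu), fun a b => ?_,
    fun u hu => h2' _ (hεk 2 u hu)⟩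
  · rw [LinearMap.comp_apply, hε, h1]
  · rw [LinearMap.comp_apply, hε2, h2]

theorem mem_lowerCentralSeries_two_of_ι_mem_layerSubspace (hM : IsSemidirectLine M x) {n : M}
    (hn : ι F (n : L) ∈ layerSubspace M x 2) : n ∈ LieModule.lowerCentralSeries F M M 2 := by
  obtain ⟨ε, hε, -, hεk⟩ := exists_retraction hM
  exact mem_lowerCentralSeries_two_of_ι_mem_pow_three (hε n ▸ hεk 2 _ hn)

end Layer

/-! ### Isomorphisms of enveloping algebras that match the ideals -/

section Transport

variable {F L H : Type*} [Field F] [LieRing L] [LieAlgebra F L] [LieRing H] [LieAlgebra F H]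
  {M : LieIdeal F L} {x : L} {N : LieIdeal F H} {y : H}
  {α : UniversalEnvelopingAlgebra F L ≃ₐ[F] UniversalEnvelopingAlgebra F H}

theorem map_symm_rightIdealGen (hα : (rightIdealGen M).map α.toLinearMap = rightIdealGen N) :
    (rightIdealGen N).map α.symm.toLinearMap = rightIdealGen M := by
  rw [← hα, ← Submodule.map_comp]
  have : α.symm.toLinearMap ∘ₗ α.toLinearMap = LinearMap.id := by ext; simp
  rw [this, Submodule.map_id]

theorem mem_rightIdealGen_iff (hα : (rightIdealGen M).map α.toLinearMap = rightIdealGen N)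
    (u : UniversalEnvelopingAlgebra F L) : α u ∈ rightIdealGen N ↔ u ∈ rightIdealGen M := by
  rw [← hα]
  constructor
  · rintro ⟨v, hv, h⟩
    rwa [← α.injective h]
  · exact fun h => ⟨u, h, rfl⟩

theorem map_pow_rightIdealGen (hα : (rightIdealGen M).map α.toLinearMap = rightIdealGen N)
    (k : ℕ) : (rightIdealGen M ^ k).map α.toLinearMap = rightIdealGen N ^ k := by
  rw [← hα]
  exact Submodule.map_pow _ α.toAlgHom k

theorem symm_apply_sub_mem (hα : (rightIdealGen M).map α.toLinearMap = rightIdealGen N)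
    (hx : α (ι F x) - ι F y ∈ rightIdealGen N) :
    α.symm (ι F y) - ι F x ∈ rightIdealGen M := by
  rw [← mem_rightIdealGen_iff hα, map_sub, AlgEquiv.apply_symm_apply, ← neg_sub]
  exact neg_mem hx

theorem apply_mem_layerSubspace (hα : (rightIdealGen M).map α.toLinearMap = rightIdealGen N)
    (hx : α (ι F x) - ι F y ∈ rightIdealGen N) (k : ℕ) :
    ∀ u ∈ layerSubspace M x k, α u ∈ layerSubspace N y k := by
  have : layerSubspace M x k ≤ (layerSubspace N y k).comap α.toLinearMap := by
    refine sup_le (fun u hu => ?_) (Submodule.mul_le.2 fun u hu v hv => ?_)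
    · exact rightIdealGen_pow_succ_le_layerSubspace k
        ((map_pow_rightIdealGen hα (k + 1)).le ⟨u, hu, rfl⟩)
    · obtain ⟨c, rfl⟩ := Submodule.mem_span_singleton.1 hv
      have hu' : α u ∈ rightIdealGen N ^ k := (map_pow_rightIdealGen hα k).le ⟨u, hu, rfl⟩
      have h : α u * α (ι F x) = α u * (α (ι F x) - ι F y) + α u * ι F y := by
        rw [mul_sub, sub_add_cancel]
      rw [mul_smul_comm]
      refine Submodule.smul_mem _ _ ?_
      rw [Submodule.mem_comap, AlgEquiv.toLinearMap_apply, map_mul, h]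
      refine Submodule.add_mem_sup ?_
        (Submodule.mul_mem_mul hu' (Submodule.mem_span_singleton_self _))
      rw [pow_succ]
      exact Submodule.mul_mem_mul hu' hx
  exact this

/-- The algebra `U(L) / M U(L)` is a polynomial ring in the class of `x`, and an isomorphism of
polynomial rings is an affine substitution. After rescaling `y` and shifting it by a scalar, `α`
therefore respects the classes of `x` and `y`. -/
theorem exists_normalized (hM : IsSemidirectLine M x) (hN : IsSemidirectLine N y)
    (hα : (rightIdealGen M).map α.toLinearMap = rightIdealGen N) :
    ∃ (c : F) (β : UniversalEnvelopingAlgebra F L ≃ₐ[F] UniversalEnvelopingAlgebra F H), c ≠ 0 ∧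
      (rightIdealGen M).map β.toLinearMap = rightIdealGen N ∧
      β (ι F x) - ι F (c • y) ∈ rightIdealGen N := by
  obtain ⟨π, hπx, hπ, hπmod⟩ := exists_algHom_polynomial hM
  obtain ⟨ρ, hρy, hρ, hρmod⟩ := exists_algHom_polynomial hN
  set p := ρ (α (ι F x)) with hp
  set q := π (α.symm (ι F y)) with hq
  have hcomp : q.comp p = Polynomial.X := by
    have h := hπmod (α.symm (ι F y))
    rw [← mem_rightIdealGen_iff hα, ← hρ, map_sub, map_sub, AlgEquiv.apply_symm_apply, hρy,
      sub_eq_zero, ← hq] at h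
    rw [h]
    have h2 : ρ (α (Polynomial.aeval (ι F x) q)) =
        (ρ.comp α.toAlgHom) (Polynomial.aeval (ι F x) q) := rfl
    rw [h2, ← Polynomial.aeval_algHom_apply]
    rw [Polynomial.comp_eq_aeval]
    rfl
  have hdeg : p.natDegree = 1 := by
    have := congrArg Polynomial.natDegree hcomp
    rw [Polynomial.natDegree_comp, Polynomial.natDegree_X] at this
    exact Nat.eq_one_of_mul_eq_one_left this
  have hpeq := Polynomial.eq_X_add_C_of_natDegree_le_one hdeg.le
  have hc : p.coeff 1 ≠ 0 := by
    intro h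
    rw [h, map_zero, zero_mul, zero_add] at hpeq
    rw [hpeq, Polynomial.natDegree_C] at hdeg
    exact zero_ne_one hdeg
  set c := p.coeff 1
  set d := p.coeff 0
  -- the automorphisms of `U(H)` that fix `N` and shift `c y` by a scalar
  have hτ : ∀ e : F, ∃ τ : UniversalEnvelopingAlgebra F H →ₐ[F] UniversalEnvelopingAlgebra F H,
      (∀ n : N, τ (ι F (n : H)) = ι F (n : H)) ∧
        τ (ι F (c • y)) = ι F (c • y) + algebraMap F _ e := fun e => by
    refine exists_algHom_of_isSemidirectLine (hN.smul hc) (ιₗ F H ∘ₗ N.toSubmodule.subtype)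
      (fun m n => ι_lie (m : H) (n : H)) _ (fun n => ?_)
    have h := ι_lie (F := F) (c • y) (n : H)
    rw [add_mul, mul_add, ← Algebra.commutes, add_sub_add_right_eq_sub]
    exact h
  obtain ⟨τ, hτN, hτy⟩ := hτ (-d)
  obtain ⟨σ, hσN, hσy⟩ := hτ d
  have hτσ : τ.comp σ = AlgHom.id F _ := algHom_ext_of_isSemidirectLine (hN.smul hc)
    (fun n => by rw [AlgHom.comp_apply, hσN, hτN, AlgHom.id_apply])
    (by rw [AlgHom.comp_apply, hσy, map_add, hτy, AlgHom.commutes, map_neg, AlgHom.id_apply,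
      neg_add_cancel_right])
  have hστ : σ.comp τ = AlgHom.id F _ := algHom_ext_of_isSemidirectLine (hN.smul hc)
    (fun n => by rw [AlgHom.comp_apply, hτN, hσN, AlgHom.id_apply])
    (by rw [AlgHom.comp_apply, hτy, map_add, hσy, AlgHom.commutes, map_neg, AlgHom.id_apply,
      add_neg_cancel_right])
  have hτJ : (rightIdealGen N).map τ.toLinearMap ≤ rightIdealGen N :=
    Submodule.map_le_iff_le_comap.2 <| rightIdealGen_induction fun n hn u => by
      rw [Submodule.mem_comap, AlgHom.toLinearMap_apply, map_mul, hτN ⟨n, hn⟩]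
      exact mul_mem_rightIdealGen hn _
  have hσJ : rightIdealGen N ≤ (rightIdealGen N).comap σ.toLinearMap :=
    rightIdealGen_induction fun n hn u => by
      rw [Submodule.mem_comap, AlgHom.toLinearMap_apply, map_mul, hσN ⟨n, hn⟩]
      exact mul_mem_rightIdealGen hn _
  refine ⟨c, α.trans (AlgEquiv.ofAlgHom τ σ hτσ hστ), hc, ?_, ?_⟩
  · have : (α.trans (AlgEquiv.ofAlgHom τ σ hτσ hστ)).toLinearMap =
        τ.toLinearMap ∘ₗ α.toLinearMap := rfl
    rw [this, Submodule.map_comp, hα]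
    exact le_antisymm hτJ fun u hu => ⟨σ u, hσJ hu, DFunLike.congr_fun hτσ u⟩
  · have h : α (ι F x) - (ι F (c • y) + algebraMap F _ d) ∈ rightIdealGen N := by
      rw [← hρ, map_sub, map_add, map_smul, map_smul, hρy, AlgHom.commutes, ← hp, hpeq,
        sub_eq_zero, Polynomial.smul_eq_C_mul]
      rfl
    have h2 := hτJ ⟨_, h, rfl⟩
    rw [AlgHom.toLinearMap_apply, map_sub, map_add, hτy, AlgHom.commutes, map_neg,
      neg_add_cancel_right] at h2
    exact h2

end Transport

/-! ### The isomorphism of the metabelian quotients -/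

section MetabelianQuotient

variable {F L H : Type*} [Field F] [LieRing L] [LieAlgebra F L] [LieRing H] [LieAlgebra F H]
  {M : LieIdeal F L} {x : L} {N : LieIdeal F H} {y : H}
  {α : UniversalEnvelopingAlgebra F L ≃ₐ[F] UniversalEnvelopingAlgebra F H}

theorem ι_mul_mem_layerSubspace_one {d : UniversalEnvelopingAlgebra F H}
    (hd : d ∈ layerSubspace N y 1) : ι F y * d ∈ layerSubspace N y 1 := by
  have : layerSubspace N y 1 ≤ (layerSubspace N y 1).comap (LinearMap.mulLeft F (ι F y)) := by
    refine sup_le (fun u hu => ?_) ?_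
    · refine rightIdealGen_pow_succ_le_layerSubspace 1 ?_
      have h := Submodule.mul_mem_mul (Submodule.mem_top (x := ι F y)) hu
      rwa [pow_succ', ← mul_assoc, top_mul_rightIdealGen, ← pow_succ'] at h
    · rw [pow_one, Submodule.mul_le]
      intro u hu v hv
      rw [Submodule.mem_comap, LinearMap.mulLeft_apply, ← mul_assoc]
      exact Submodule.mem_sup_right (by
        rw [pow_one]; exact Submodule.mul_mem_mul (mul_mem_rightIdealGen_left hu _) hv)
  exact this hd

theorem mul_ι_mem_layerSubspace_one {d : UniversalEnvelopingAlgebra F H}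
    (hd : d ∈ layerSubspace N y 1) : d * ι F y ∈ layerSubspace N y 1 := by
  have hJ : d ∈ rightIdealGen N := by
    have : layerSubspace N y 1 ≤ rightIdealGen N := by
      refine sup_le ?_ ?_
      · rw [sq]
        exact Submodule.mul_le.2 fun u hu v _ => mul_mem_rightIdealGen_right hu v
      · rw [pow_one]
        exact Submodule.mul_le.2 fun u hu v _ => mul_mem_rightIdealGen_right hu v
    exact this hd
  exact Submodule.mem_sup_right (by
    rw [pow_one]; exact Submodule.mul_mem_mul hJ (Submodule.mem_span_singleton_self _))

theorem apply_ι_mem (hα : (rightIdealGen M).map α.toLinearMap = rightIdealGen N) (m : M) :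
    α (ι F (m : L)) ∈ rightIdealGen N :=
  (mem_rightIdealGen_iff hα _).2 (ι_mem_rightIdealGen m.2)

/-- Modulo `J² + J y`, where `J = N U(H)`, the image under `α` of an element of `M` is an element
of `N`. -/
theorem exists_apply_ι_sub_mem (hN : IsSemidirectLine N y)
    (hα : (rightIdealGen M).map α.toLinearMap = rightIdealGen N) (m : M) :
    ∃ n : N, α (ι F (m : L)) - ι F (n : H) ∈ layerSubspace N y 1 := by
  obtain ⟨_, ⟨n, hn, rfl⟩, d, hd, h⟩ := Submodule.mem_sup.1
    (rightIdealGen_le_sup_layerSubspace hN (apply_ι_mem hα m))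
  exact ⟨⟨n, hn⟩, by rw [← h, ιₗ_apply, add_sub_cancel_left]; exact hd⟩

/-- The correspondence of `M` and `N` modulo `J² + J y` intertwines the actions of `x` and `y`. -/
theorem apply_ι_lie_sub_mem (hα : (rightIdealGen M).map α.toLinearMap = rightIdealGen N)
    (hx : α (ι F x) - ι F y ∈ rightIdealGen N) {m : M} {n : N}
    (h : α (ι F (m : L)) - ι F (n : H) ∈ layerSubspace N y 1) :
    α (ι F ((⁅x, m⁆ : M) : L)) - ι F ((⁅y, n⁆ : N) : H) ∈ layerSubspace N y 1 := by
  have hm := apply_ι_mem hα m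
  have h1 : α (ι F ((⁅x, m⁆ : M) : L)) - ι F ((⁅y, n⁆ : N) : H) =
      (α (ι F x) - ι F y) * α (ι F (m : L)) - α (ι F (m : L)) * (α (ι F x) - ι F y) +
        (ι F y * (α (ι F (m : L)) - ι F (n : H)) - (α (ι F (m : L)) - ι F (n : H)) * ι F y) := by
    rw [LieSubmodule.coe_bracket, LieSubmodule.coe_bracket, ι_lie, ι_lie, map_sub, map_mul,
      map_mul]
    noncomm_ring
  rw [h1]
  refine add_mem (rightIdealGen_pow_succ_le_layerSubspace 1 ?_)
    (sub_mem (ι_mul_mem_layerSubspace_one h) (mul_ι_mem_layerSubspace_one h))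
  rw [sq]
  exact sub_mem (Submodule.mul_mem_mul hx hm) (Submodule.mul_mem_mul hm hx)

/-- A linear map on `N` that kills `[N, N]` is transported by `α` to one on `M`. -/
theorem exists_linearMap_transport (hN : IsSemidirectLine N y)
    (hα : (rightIdealGen M).map α.toLinearMap = rightIdealGen N)
    {P : Type*} [AddCommGroup P] [Module F P] (p : N →ₗ[F] P) (hp : ∀ a b : N, p ⁅a, b⁆ = 0) :
    ∃ φ : M →ₗ[F] P, (∀ (m : M) (n : N),
        α (ι F (m : L)) - ι F (n : H) ∈ layerSubspace N y 1 → φ m = p n) ∧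
      ∀ a b : M, φ ⁅a, b⁆ = 0 := by
  obtain ⟨t, -, ht, ht1, -, -⟩ := exists_linearMap_layerSubspace hN p (0 : P →ₗ[F] P →ₗ[F] P) hp
    (fun _ _ => rfl)
  refine ⟨t ∘ₗ α.toLinearMap ∘ₗ ιₗ F L ∘ₗ M.toSubmodule.subtype, fun m n h => ?_, fun a b => ?_⟩
  · have := ht1 _ h
    rwa [map_sub, sub_eq_zero, ht] at this
  · refine ht1 _ (rightIdealGen_pow_succ_le_layerSubspace 1 ?_)
    have h : α (ι F ⁅(a : L), (b : L)⁆) = α (ι F (a : L)) * α (ι F (b : L)) -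
        α (ι F (b : L)) * α (ι F (a : L)) := by rw [ι_lie, map_sub, map_mul, map_mul]
    change α (ι F ⁅(a : L), (b : L)⁆) ∈ _
    rw [h, sq]
    exact sub_mem (Submodule.mul_mem_mul (apply_ι_mem hα a) (apply_ι_mem hα b))
      (Submodule.mul_mem_mul (apply_ι_mem hα b) (apply_ι_mem hα a))

theorem _root_.LieIdeal.exists_lieHom_quotient {G : Type*} [LieRing G] [LieAlgebra F G]
    (I : LieIdeal F L) (g : L →ₗ⁅F⁆ G) (hg : ∀ a ∈ I, g a = 0) :
    ∃ h : L ⧸ I →ₗ⁅F⁆ G, ∀ a, h (LieSubmodule.Quotient.mk a) = g a := by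
  refine ⟨{ I.toSubmodule.liftQ (g : L →ₗ[F] G) hg with map_lie' := ?_ }, fun a => rfl⟩
  intro a b
  obtain ⟨a, rfl⟩ := LieSubmodule.Quotient.surjective_mk' I a
  obtain ⟨b, rfl⟩ := LieSubmodule.Quotient.surjective_mk' I b
  exact g.map_lie a b

/-- The correspondence of `M` and `N` modulo `J² + J y`, extended by `x ↦ y`, is a homomorphism of
the quotients by `[M, M]` and `[N, N]`. -/
theorem exists_lieHom_quotient_lie (hM : IsSemidirectLine M x) (hN : IsSemidirectLine N y)
    (hα : (rightIdealGen M).map α.toLinearMap = rightIdealGen N)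
    (hx : α (ι F x) - ι F y ∈ rightIdealGen N) :
    ∃ g : L ⧸ ⁅M, M⁆ →ₗ⁅F⁆ H ⧸ ⁅N, N⁆,
      (∀ (m : M) (n : N), α (ι F (m : L)) - ι F (n : H) ∈ layerSubspace N y 1 →
        g (LieSubmodule.Quotient.mk (m : L)) = LieSubmodule.Quotient.mk (n : H)) ∧
      g (LieSubmodule.Quotient.mk x) = LieSubmodule.Quotient.mk y := by
  have hbr : ∀ a b : N, (LieSubmodule.Quotient.mk (N := ⁅N, N⁆) ⁅(a : H), (b : H)⁆) = 0 :=
    fun a b => LieSubmodule.Quotient.mk_eq_zero'.2 (LieSubmodule.lie_mem_lie a.2 b.2)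
  obtain ⟨φ, hφ, hφ0⟩ := exists_linearMap_transport hN hα
    ((LieSubmodule.Quotient.mk' ⁅N, N⁆ : H →ₗ[F] H ⧸ ⁅N, N⁆) ∘ₗ N.toSubmodule.subtype) hbr
  have hφ' : ∀ (m : M) (n : N), α (ι F (m : L)) - ι F (n : H) ∈ layerSubspace N y 1 →
      φ m = LieSubmodule.Quotient.mk (n : H) := hφ
  obtain ⟨g, hg, hgx⟩ := hM.exists_lieHom φ (fun a b => by
      obtain ⟨c, hc⟩ := exists_apply_ι_sub_mem hN hα a
      obtain ⟨d, hd⟩ := exists_apply_ι_sub_mem hN hα b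
      rw [hφ0, hφ' _ _ hc, hφ' _ _ hd, ← LieSubmodule.Quotient.mk_bracket, hbr])
    (LieSubmodule.Quotient.mk y) (fun a => by
      obtain ⟨c, hc⟩ := exists_apply_ι_sub_mem hN hα a
      rw [hφ' _ _ hc, hφ' _ _ (apply_ι_lie_sub_mem hα hx hc), ← LieSubmodule.Quotient.mk_bracket]
      rfl)
  have hgMM : ∀ a ∈ ⁅M, M⁆, g a = 0 := by
    have : ⁅M, M⁆ ≤ g.ker := (LieSubmodule.lie_le_iff _ _ _).2 fun a ha b hb => by
      rw [LieHom.mem_ker]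
      exact (hg ⁅(⟨a, ha⟩ : M), (⟨b, hb⟩ : M)⁆).trans (hφ0 _ _)
    exact fun a ha => LieHom.mem_ker.1 (this ha)
  obtain ⟨h, hh⟩ := LieIdeal.exists_lieHom_quotient _ g hgMM
  exact ⟨h, fun m n hmn => by rw [hh, hg, hφ' _ _ hmn], by rw [hh, hgx]⟩

theorem symm_apply_ι_sub_mem (hα : (rightIdealGen M).map α.toLinearMap = rightIdealGen N)
    (hx : α (ι F x) - ι F y ∈ rightIdealGen N) {m : M} {n : N}
    (h : α (ι F (m : L)) - ι F (n : H) ∈ layerSubspace N y 1) :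
    α.symm (ι F (n : H)) - ι F (m : L) ∈ layerSubspace M x 1 := by
  have := apply_mem_layerSubspace (map_symm_rightIdealGen hα)
    (symm_apply_sub_mem hα hx) 1 _ h
  rw [map_sub, AlgEquiv.symm_apply_apply, ← neg_sub] at this
  exact neg_mem_iff.1 this

/-- The maps in both directions between `L / [M, M]` and `H / [N, N]` are inverse to each other. -/
theorem quotient_lie_leftInverse (hM : IsSemidirectLine M x)
    (hN : IsSemidirectLine N y) (hα : (rightIdealGen M).map α.toLinearMap = rightIdealGen N)
    (hx : α (ι F x) - ι F y ∈ rightIdealGen N)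
    {g : L ⧸ ⁅M, M⁆ →ₗ⁅F⁆ H ⧸ ⁅N, N⁆} {h : H ⧸ ⁅N, N⁆ →ₗ⁅F⁆ L ⧸ ⁅M, M⁆}
    (hg : ∀ (m : M) (n : N), α (ι F (m : L)) - ι F (n : H) ∈ layerSubspace N y 1 →
        g (LieSubmodule.Quotient.mk (m : L)) = LieSubmodule.Quotient.mk (n : H))
    (hgx : g (LieSubmodule.Quotient.mk x) = LieSubmodule.Quotient.mk y)
    (hh : ∀ (n : N) (m : M), α.symm (ι F (n : H)) - ι F (m : L) ∈ layerSubspace M x 1 →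
        h (LieSubmodule.Quotient.mk (n : H)) = LieSubmodule.Quotient.mk (m : L))
    (hhy : h (LieSubmodule.Quotient.mk y) = LieSubmodule.Quotient.mk x) :
    Function.LeftInverse h g := by
  intro a
  obtain ⟨a, rfl⟩ := LieSubmodule.Quotient.surjective_mk' _ a
  obtain ⟨m, c, rfl⟩ := hM.exists_eq_add a
  obtain ⟨n, hn⟩ := exists_apply_ι_sub_mem hN hα m
  rw [map_add, map_smul, map_add, map_smul, map_add, map_smul]
  simp only [LieSubmodule.Quotient.mk'_apply]
  rw [hg _ _ hn, hgx, hh _ _ (symm_apply_ι_sub_mem hα hx hn), hhy]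

theorem nonempty_quotient_lie_equiv (hM : IsSemidirectLine M x) (hN : IsSemidirectLine N y)
    (hα : (rightIdealGen M).map α.toLinearMap = rightIdealGen N)
    (hx : α (ι F x) - ι F y ∈ rightIdealGen N) :
    Nonempty ((L ⧸ ⁅M, M⁆) ≃ₗ⁅F⁆ (H ⧸ ⁅N, N⁆)) := by
  have hα' := map_symm_rightIdealGen hα
  have hx' := symm_apply_sub_mem hα hx
  obtain ⟨g, hg, hgx⟩ := exists_lieHom_quotient_lie hM hN hα hx
  obtain ⟨h, hh, hhy⟩ := exists_lieHom_quotient_lie hN hM hα' hx'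
  exact ⟨{ g with
    invFun := h
    left_inv := quotient_lie_leftInverse hM hN hα hx hg hgx hh hhy
    right_inv := quotient_lie_leftInverse hN hM hα' hx' hh hhy hg hgx }⟩

end MetabelianQuotient

open scoped TensorProduct

/-! ### Abelian ideals correspond to abelian ideals -/

section Abelian

variable {F L H : Type*} [Field F] [LieRing L] [LieAlgebra F L] [LieRing H] [LieAlgebra F H]
  {M : LieIdeal F L} {x : L} {N : LieIdeal F H} {y : H}
  {α : UniversalEnvelopingAlgebra F L ≃ₐ[F] UniversalEnvelopingAlgebra F H}

/-- If `M` is abelian, the second layer of the filtration of `U(L)` is spanned by symmetric products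
of elements of `M`. That of `U(H)` maps onto the symmetric square of `N / [N, N] ≅ M`. Since the
symmetric square of `M` has finite dimension, there is no room in the second layer for commutators
of `N`. -/
theorem ι_lie_mem_layerSubspace [FiniteDimensional F L] (hM : IsSemidirectLine M x)
    (hN : IsSemidirectLine N y) (hα : (rightIdealGen M).map α.toLinearMap = rightIdealGen N)
    (hx : α (ι F x) - ι F y ∈ rightIdealGen N) (hab : ∀ a b : M, ⁅a, b⁆ = 0) (n n' : N) :
    ι F ⁅(n : H), (n' : H)⁆ ∈ layerSubspace N y 2 := by
  obtain ⟨ψ, hψ, hψ0⟩ := exists_linearMap_transport hM (map_symm_rightIdealGen hα)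
    (LinearMap.id : M →ₗ[F] M) hab
  have hψs : Function.Surjective ψ := fun m => by
    obtain ⟨n, hn⟩ := exists_apply_ι_sub_mem hN hα m
    exact ⟨n, hψ _ _ (symm_apply_ι_sub_mem hα hx hn)⟩
  -- the symmetric square of `M`
  let A : Submodule F (M ⊗[F] M) := Submodule.span F {t | ∃ a b : M, t = a ⊗ₜ b - b ⊗ₜ a}
  let f : M →ₗ[F] M →ₗ[F] (M ⊗[F] M) ⧸ A := (TensorProduct.mk F M M).compr₂ A.mkQ
  have hfa : ∀ a b, f a b = A.mkQ (a ⊗ₜ b) := fun a b => rfl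
  have hf : ∀ a b, f a b = f b a := fun a b => by
    rw [hfa, hfa, ← sub_eq_zero, ← map_sub, Submodule.mkQ_apply, Submodule.Quotient.mk_eq_zero]
    exact Submodule.subset_span ⟨a, b, rfl⟩
  obtain ⟨-, t, -, -, ht, ht2⟩ := exists_linearMap_layerSubspace hN ψ f hψ0 (fun a b => hf _ _)
  let χ : (UniversalEnvelopingAlgebra F H ⧸ layerSubspace N y 2) →ₗ[F] (M ⊗[F] M) ⧸ A :=
    (layerSubspace N y 2).liftQ t ht2
  have hχ : ∀ u, χ ((layerSubspace N y 2).mkQ u) = t u := fun u => rfl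
  let l : M →ₗ[F] UniversalEnvelopingAlgebra F H :=
    α.toLinearMap ∘ₗ ιₗ F L ∘ₗ M.toSubmodule.subtype
  have hl : ∀ a : M, l a = α (ι F (a : L)) := fun a => rfl
  have hcomm : ∀ a b, l a * l b = l b * l a := fun a b => by
    have h : ι F ⁅(a : L), (b : L)⁆ = 0 := by
      have := congrArg (Subtype.val) (hab a b)
      rw [show ⁅(a : L), (b : L)⁆ = 0 from this, map_zero]
    rw [hl, hl, ← map_mul α, ← map_mul α, ← sub_eq_zero, ← map_sub α, ← ι_lie, h, map_zero]
  let B : M →ₗ[F] M →ₗ[F] (UniversalEnvelopingAlgebra F H ⧸ layerSubspace N y 2) :=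
    ((LinearMap.mul F (UniversalEnvelopingAlgebra F H)).compl₁₂ l l).compr₂
      (layerSubspace N y 2).mkQ
  have hB : ∀ a b, B a b = (layerSubspace N y 2).mkQ (l a * l b) := fun a b => rfl
  let σ : (M ⊗[F] M) ⧸ A →ₗ[F] (UniversalEnvelopingAlgebra F H ⧸ layerSubspace N y 2) :=
    A.liftQ (TensorProduct.lift B) (Submodule.span_le.2 (by
      rintro _ ⟨a, b, rfl⟩
      simp only [SetLike.mem_coe, LinearMap.mem_ker, map_sub, TensorProduct.lift.tmul, hB, hcomm a,
        sub_self]))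
  have hσ : ∀ a b, σ (A.mkQ (a ⊗ₜ b)) = (layerSubspace N y 2).mkQ (l a * l b) := fun a b => by
    rw [← hB]; exact (A.liftQ_apply _ _).trans (TensorProduct.lift.tmul a b)
  have hrange : ∀ u ∈ rightIdealGen N ^ 2,
      (layerSubspace N y 2).mkQ u ∈ LinearMap.range σ := by
    have h : rightIdealGen M ^ 2 ≤ (LinearMap.range σ).comap
        ((layerSubspace N y 2).mkQ ∘ₗ α.toLinearMap) := by
      refine (rightIdealGen_sq_le_sup_layerSubspace hM).trans (sup_le (Submodule.mul_le.2 ?_) ?_)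
      · rintro _ ⟨a, ha, rfl⟩ _ ⟨b, hb, rfl⟩
        refine ⟨A.mkQ (⟨a, ha⟩ ⊗ₜ ⟨b, hb⟩), ?_⟩
        rw [hσ]
        exact congrArg _ (map_mul α _ _).symm
      · intro u hu
        have h0 : (layerSubspace N y 2).mkQ (α u) = 0 := by
          rw [Submodule.mkQ_apply, Submodule.Quotient.mk_eq_zero]
          exact apply_mem_layerSubspace hα hx 2 u hu
        rw [Submodule.mem_comap, LinearMap.comp_apply, AlgEquiv.toLinearMap_apply, h0]
        exact zero_mem _
    intro u hu
    rw [← map_pow_rightIdealGen hα] at hu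
    obtain ⟨v, hv, rfl⟩ := hu
    exact h hv
  have hmem : ∀ a b : N, ι F (a : H) * ι F (b : H) ∈ rightIdealGen N ^ 2 := fun a b => by
    rw [sq]
    exact Submodule.mul_mem_mul (ι_mem_rightIdealGen a.2) (ι_mem_rightIdealGen b.2)
  have hsurj : Function.Surjective (χ ∘ₗ σ) := by
    rw [← LinearMap.range_eq_top, eq_top_iff]
    rintro z -
    obtain ⟨z, rfl⟩ := A.mkQ_surjective z
    induction z using TensorProduct.induction_on with
    | zero => rw [map_zero]; exact zero_mem _
    | add z w hz hw => rw [map_add]; exact add_mem hz hw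
    | tmul a b =>
      obtain ⟨a, rfl⟩ := hψs a
      obtain ⟨b, rfl⟩ := hψs b
      obtain ⟨s, hs⟩ := hrange _ (hmem a b)
      exact ⟨s, by rw [LinearMap.comp_apply, hs, hχ, ht, hfa]⟩
  have hinj := LinearMap.injective_iff_surjective.2 hsurj
  obtain ⟨s, hs⟩ := hrange (ι F ⁅(n : H), (n' : H)⁆) (by
    rw [ι_lie]; exact sub_mem (hmem n n') (hmem n' n))
  have hs0 : s = 0 := hinj (by
    rw [LinearMap.comp_apply, hs, hχ, ι_lie, map_sub, ht, ht, hf, sub_self, map_zero])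
  rw [hs0, map_zero] at hs
  exact (Submodule.Quotient.mk_eq_zero _).1 hs.symm

theorem lowerCentralSeries_one_le_of_le_two
    (h : LieModule.lowerCentralSeries F L L 1 ≤ LieModule.lowerCentralSeries F L L 2) (k : ℕ) :
    LieModule.lowerCentralSeries F L L 1 ≤ LieModule.lowerCentralSeries F L L (k + 1) := by
  induction k with
  | zero => exact le_rfl
  | succ k ih =>
    rw [LieModule.lowerCentralSeries_succ F L L (k + 1)]
    exact h.trans (LieSubmodule.mono_lie_right _ ih)

theorem ι_mem_rightIdealGen_pow_of_mem_lowerCentralSeries (k : ℕ) :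
    ∀ z ∈ LieModule.lowerCentralSeries F N N k, ι F (z : H) ∈ rightIdealGen N ^ (k + 1) := by
  induction k with
  | zero => intro z _; rw [zero_add, pow_one]; exact ι_mem_rightIdealGen z.2
  | succ k ih =>
    have h : (LieModule.lowerCentralSeries F N N (k + 1)).toSubmodule ≤
        (rightIdealGen N ^ (k + 1 + 1)).comap (ιₗ F H ∘ₗ N.toSubmodule.subtype) := by
      rw [LieModule.lowerCentralSeries_succ, LieSubmodule.lieIdeal_oper_eq_linear_span',
        Submodule.span_le]
      rintro _ ⟨a, -, b, hb, rfl⟩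
      have h : ι F ⁅(a : H), (b : H)⁆ = ι F (a : H) * ι F (b : H) - ι F (b : H) * ι F (a : H) :=
        ι_lie _ _
      change ι F ⁅(a : H), (b : H)⁆ ∈ rightIdealGen N ^ (k + 1 + 1)
      rw [h]
      refine sub_mem ?_ ?_
      · rw [pow_succ']
        exact Submodule.mul_mem_mul (ι_mem_rightIdealGen a.2) (ih b hb)
      · rw [pow_succ]
        exact Submodule.mul_mem_mul (ih b hb) (ι_mem_rightIdealGen a.2)
    exact h

/-- If `M` is abelian, then the powers of `M U(L)` intersect in zero. -/
theorem eq_zero_of_forall_mem_rightIdealGen_pow (hM : IsSemidirectLine M x)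
    (hab : ∀ a b : M, ⁅a, b⁆ = 0) {u : UniversalEnvelopingAlgebra F L}
    (hu : ∀ k, u ∈ rightIdealGen M ^ (k + 1)) : u = 0 := by
  obtain ⟨Ψ, hΨ, -, -, -, hΨJ⟩ := exists_normalOrdering hM
  refine hΨ ((Finsupp.ext fun i => ?_).trans (map_zero Ψ).symm)
  exact eq_zero_of_forall_mem_pow hab fun k => hΨJ k u (hu k) i

/-- The adjoint representation factors through `U(H)`. -/
theorem lie_eq_zero_of_ι_eq_zero {z : H} (hz : ι F z = 0) (h : H) : ⁅z, h⁆ = 0 := by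
  obtain ⟨φ, hφ⟩ := exists_algHom (LieModule.toEnd F H H : H →ₗ[F] Module.End F H) (fun a b => by
    ext h; simp)
  have := hφ z
  rw [hz, map_zero] at this
  exact (LinearMap.congr_fun this h).symm

/-- If `M` is abelian, then so is `N`: first `[N, N] = [N, [N, N]]`, and then `[N, N]` is central
in `H`. -/
theorem lie_eq_zero_of_lie_eq_zero [FiniteDimensional F L] (hM : IsSemidirectLine M x)
    (hN : IsSemidirectLine N y) (hα : (rightIdealGen M).map α.toLinearMap = rightIdealGen N)
    (hx : α (ι F x) - ι F y ∈ rightIdealGen N) (hab : ∀ a b : M, ⁅a, b⁆ = 0) (n n' : N) :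
    ⁅n, n'⁆ = 0 := by
  have h12 : LieModule.lowerCentralSeries F N N 1 ≤ LieModule.lowerCentralSeries F N N 2 :=
    (LieSubmodule.lie_le_iff _ _ _).2 fun a _ b _ =>
      mem_lowerCentralSeries_two_of_ι_mem_layerSubspace hN
        (ι_lie_mem_layerSubspace hM hN hα hx hab a b)
  have h1k : ∀ k, LieModule.lowerCentralSeries F N N 1 ≤
      LieModule.lowerCentralSeries F N N (k + 1) :=
    lowerCentralSeries_one_le_of_le_two h12
  -- `[N, N]` vanishes in `U(H)`, hence is central in `H`
  have hι : ∀ z ∈ LieModule.lowerCentralSeries F N N 1, ι F (z : H) = 0 := fun z hz => by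
    have h0 : α.symm (ι F (z : H)) = 0 := by
      refine eq_zero_of_forall_mem_rightIdealGen_pow hM hab fun k => ?_
      rw [← map_pow_rightIdealGen (map_symm_rightIdealGen hα)]
      refine ⟨_, ?_, rfl⟩
      have := ι_mem_rightIdealGen_pow_of_mem_lowerCentralSeries (k + 1) z (h1k k hz)
      rw [pow_succ] at this
      have hle : rightIdealGen N ^ (k + 1) * rightIdealGen N ≤ rightIdealGen N ^ (k + 1) * ⊤ :=
        mul_le_mul' le_rfl le_top
      exact rightIdealGen_pow_succ_mul_top (M := N) k ▸ hle this
    simpa [-ι_apply] using h0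
  have h2 : LieModule.lowerCentralSeries F N N 2 ≤ ⊥ :=
    (LieSubmodule.lie_le_iff _ _ _).2 fun a _ b hb => by
      rw [LieSubmodule.mem_bot, ← lie_skew, neg_eq_zero]
      exact Subtype.ext (lie_eq_zero_of_ι_eq_zero (hι b hb) (a : H))
  exact (LieSubmodule.mem_bot _).1 (h2 (h12 (LieSubmodule.lie_mem_lie
    (LieSubmodule.mem_top n) (LieSubmodule.mem_top n'))))

end Abelian

/-! ### The commutator ideal -/

section Commutator

variable {F L H : Type*} [Field F] [LieRing L] [LieAlgebra F L] [LieRing H] [LieAlgebra F H]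
  {x : L} {y : H}

theorem map_rightIdealGen_derivedSeries_le
    (hN : IsSemidirectLine (LieAlgebra.derivedSeries F H 1) y)
    (α : UniversalEnvelopingAlgebra F L →ₐ[F] UniversalEnvelopingAlgebra F H) :
    (rightIdealGen (LieAlgebra.derivedSeries F L 1)).map α.toLinearMap ≤
      rightIdealGen (LieAlgebra.derivedSeries F H 1) := by
  obtain ⟨π, -, hπ, -⟩ := exists_algHom_polynomial hN
  have h : (LieAlgebra.derivedSeries F L 1).toSubmodule ≤
      (rightIdealGen (LieAlgebra.derivedSeries F H 1)).comap (α.toLinearMap ∘ₗ ιₗ F L) := by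
    have : (LieAlgebra.derivedSeries F L 1).toSubmodule =
        (⁅(⊤ : LieIdeal F L), (⊤ : LieIdeal F L)⁆).toSubmodule := rfl
    rw [this, LieSubmodule.lieIdeal_oper_eq_linear_span', Submodule.span_le]
    rintro _ ⟨a, -, b, -, rfl⟩
    change α (ι F ⁅a, b⁆) ∈ rightIdealGen (LieAlgebra.derivedSeries F H 1)
    rw [← hπ, ι_lie, map_sub, map_sub, map_mul, map_mul, map_mul, map_mul, mul_comm, sub_self]
  refine Submodule.map_le_iff_le_comap.2 (rightIdealGen_induction fun m hm u => ?_)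
  rw [Submodule.mem_comap, AlgHom.toLinearMap_apply, map_mul]
  exact mul_mem_rightIdealGen_right (h hm) _

/-- The ideal `L' U(L)` is generated by the commutators of `U(L)`, so every isomorphism of
enveloping algebras preserves it. -/
theorem map_rightIdealGen_derivedSeries (hM : IsSemidirectLine (LieAlgebra.derivedSeries F L 1) x)
    (hN : IsSemidirectLine (LieAlgebra.derivedSeries F H 1) y)
    (α : UniversalEnvelopingAlgebra F L ≃ₐ[F] UniversalEnvelopingAlgebra F H) :
    (rightIdealGen (LieAlgebra.derivedSeries F L 1)).map α.toLinearMap =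
      rightIdealGen (LieAlgebra.derivedSeries F H 1) :=
  le_antisymm (map_rightIdealGen_derivedSeries_le hN α.toAlgHom) fun u hu =>
    ⟨α.symm u, map_rightIdealGen_derivedSeries_le hM α.symm.toAlgHom ⟨u, hu, rfl⟩,
      α.apply_symm_apply u⟩

end Commutator

/-! ### Comparison of the Lie algebras -/

section Comparison

variable {F L H : Type*} [Field F] [LieRing L] [LieAlgebra F L] [LieRing H] [LieAlgebra F H]
  {M : LieIdeal F L} {x : L} {N : LieIdeal F H} {y : H}
  {α : UniversalEnvelopingAlgebra F L ≃ₐ[F] UniversalEnvelopingAlgebra F H}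

theorem _root_.LieIdeal.nonempty_quotient_equiv_of_eq_bot {I : LieIdeal F L} (hI : I = ⊥) :
    Nonempty ((L ⧸ I) ≃ₗ⁅F⁆ L) := by
  subst hI
  obtain ⟨g, hg⟩ := LieIdeal.exists_lieHom_quotient (⊥ : LieIdeal F L) (1 : L →ₗ⁅F⁆ L)
    (fun a ha => (LieSubmodule.mem_bot a).1 ha)
  exact ⟨{ g with
    invFun := LieSubmodule.Quotient.mk
    left_inv := fun a => by
      obtain ⟨a, rfl⟩ := LieSubmodule.Quotient.surjective_mk' _ a
      exact congrArg _ (hg a)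
    right_inv := fun a => hg a }⟩

theorem nonempty_quotient_lie_equiv_of_map_eq (hM : IsSemidirectLine M x)
    (hN : IsSemidirectLine N y)
    (hα : (rightIdealGen M).map α.toLinearMap = rightIdealGen N) :
    Nonempty ((L ⧸ ⁅M, M⁆) ≃ₗ⁅F⁆ (H ⧸ ⁅N, N⁆)) := by
  obtain ⟨c, β, hc, hβ, hx⟩ := exists_normalized hM hN hα
  exact nonempty_quotient_lie_equiv hM (hN.smul hc) hβ hx

theorem lie_self_eq_bot_of_lie_self_eq_bot [FiniteDimensional F L] (hM : IsSemidirectLine M x)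
    (hN : IsSemidirectLine N y)
    (hα : (rightIdealGen M).map α.toLinearMap = rightIdealGen N) (h : ⁅M, M⁆ = ⊥) :
    ⁅N, N⁆ = ⊥ := by
  obtain ⟨c, β, hc, hβ, hx⟩ := exists_normalized hM hN hα
  rw [← LieSubmodule.lie_abelian_iff_lie_self_eq_bot] at h ⊢
  exact ⟨lie_eq_zero_of_lie_eq_zero hM (hN.smul hc) hβ hx h.trivial⟩

theorem nonempty_equiv_of_lie_self_eq_bot [FiniteDimensional F L] [FiniteDimensional F H]
    (hM : IsSemidirectLine M x) (hN : IsSemidirectLine N y)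
    (hα : (rightIdealGen M).map α.toLinearMap = rightIdealGen N)
    (h : ⁅M, M⁆ = ⊥ ∨ ⁅N, N⁆ = ⊥) : Nonempty (L ≃ₗ⁅F⁆ H) := by
  have hMN : ⁅M, M⁆ = ⊥ ∧ ⁅N, N⁆ = ⊥ := by
    rcases h with h | h
    · exact ⟨h, lie_self_eq_bot_of_lie_self_eq_bot hM hN hα h⟩
    · exact ⟨lie_self_eq_bot_of_lie_self_eq_bot hN hM (map_symm_rightIdealGen hα) h, h⟩
  obtain ⟨e₁⟩ := LieIdeal.nonempty_quotient_equiv_of_eq_bot hMN.1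
  obtain ⟨e₂⟩ := LieIdeal.nonempty_quotient_equiv_of_eq_bot hMN.2
  obtain ⟨e⟩ := nonempty_quotient_lie_equiv_of_map_eq hM hN hα
  exact ⟨(e₁.symm.trans e).trans e₂⟩

end Comparison

end UniversalEnvelopingAlgebra

open UniversalEnvelopingAlgebra in
theorem mainTheorem4 {F L H : Type*} [Field F]
    [LieRing L] [LieAlgebra F L] [FiniteDimensional F L]
    [LieRing H] [LieAlgebra F H] [FiniteDimensional F H]
    (M : LieIdeal F L) (x : L) (hM : IsSemidirectLine M x)
    (N : LieIdeal F H) (y : H) (hN : IsSemidirectLine N y)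
    (α : UniversalEnvelopingAlgebra F L ≃ₐ[F] UniversalEnvelopingAlgebra F H) :
    -- part (1)
    ((rightIdealGen M).map α.toLinearMap = rightIdealGen N →
      (IsLieAbelian M ∨ IsLieAbelian N) → Nonempty (L ≃ₗ⁅F⁆ H)) ∧
    -- part (2)
    (M = LieAlgebra.derivedSeries F L 1 → N = LieAlgebra.derivedSeries F H 1 →
      Nonempty ((L ⧸ LieAlgebra.derivedSeries F L 2) ≃ₗ⁅F⁆
        (H ⧸ LieAlgebra.derivedSeries F H 2)) ∧
      ((IsMetabelian F L ∨ IsMetabelian F H) → Nonempty (L ≃ₗ⁅F⁆ H))) := by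
  refine ⟨fun hα h => ?_, fun hML hNH => ?_⟩
  · rw [LieSubmodule.lie_abelian_iff_lie_self_eq_bot,
      LieSubmodule.lie_abelian_iff_lie_self_eq_bot] at h
    exact nonempty_equiv_of_lie_self_eq_bot hM hN hα h
  · subst hML hNH
    have hα := map_rightIdealGen_derivedSeries hM hN α
    exact ⟨nonempty_quotient_lie_equiv_of_map_eq hM hN hα,
      nonempty_equiv_of_lie_self_eq_bot hM hN hα⟩
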